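/- **Setting.** Let $\mathcal X$ be a complex Hilbert space, $\mathcal X'$ its anti-dual (bounded anti-linear functionals, operator norm), $\langle\chi,f\rangle=f(\chi)$ for $\chi\in\mathcal X$, $f\in\mathcal X'$. Let $A(s):\mathcal X\to\mathcal X'$, $\operatorname{Re}s>0$, be an analytic family of bounded linear operators such that for every $\sigma>0$ there are $M_\sigma$ and $\alpha_\sigma>0$ with $$\|A(s)\|_{\mathcal X'\leftarrow\mathcal X}\le M_\sigma|s|^2,\qquad \operatorname{Re}\langle\phi,A(s)\phi\rangle\ge\alpha_\sigma\|s^{-1}\phi\|_{\mathcal X}^2\qquad(\phi\in\mathcal X,\ \operatorname{Re}s\ge\sigma).$$ For $E\in\{\mathcal X,\mathcal X'\}$, real $r\ge0$ and $T>0$, let $H^r_0(0,T;E)$ be the space of restrictions to $(0,T)$ of those $G\in H^r(\mathbb R;E)$ that vanish on $(-\infty,0)$, with the quotient norm $\|g\|_{H^r_0(0,T;E)}=\inf\{\|G\|_{H^r(\mathbb R;E)}: G|_{(0,T)}=g,\ G|_{(-\infty,0)}=0\}$, where $\|G\|_{H^r(\mathbb R;E)}=\|\mathcal F^{-1}(1+\xi^2)^{r/2}\mathcal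 FG\|_{L^2(\mathbb R;E)}$ and $\mathcal FG(\xi)=\int e^{-2\pi i\xi t}G(t)\,dt$ (this norm is understood as $\infty$ for functions outside the space). Functions on $(0,T)$ are extended by zero to $(-\infty,0)$, and $A(\partial_t)\phi=(\mathcal L^{-1}A)*\phi$ is the distribution on $(-\infty,T)$ given by $$A(\partial_t)\phi=\partial_t^4\int_0^t\kappa(t-\tau)\phi(\tau)\,d\tau,\qquad \kappa(t)=\frac1{2\pi i}\int_{1-i\infty}^{1+i\infty}e^{st}s^{-4}A(s)\,ds.$$ The convolution equation $A(\partial_t)\phi=g$ on $(0,T)$ is understood as equality of distributions on $(-\infty,T)$. For a finite-dimensional subspace $\mathcal X_h\subset\mathcal X$, a Galerkin semi-discrete solution is a function $\phi_h$ on $(0,T)$ with values in $\mathcal X_h$ (almost everywhere) such that $$\langle\chi_h,A(\partial_t)\phi_h\rangle=\langle\chi_h,g\rangle\quad\text{for all }\chi_h\in\mathcal X_h,$$ in the same sense. Let $\Pi_h$ be the $\mathcal X$-orthogonal projection of $\mathcal X$ onto $\mathcal X_h$. **Lemma 4.1.** Let $m\ge0$ be real and $T>0$. There is a constant $c>0$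 depending only on $m$ and $T$ such that, for all $\mathcal X$, $A$, $(M_\sigma)$, $(\alpha_\sigma)$ as above, every finite-dimensional subspace $\mathcal X_h\subset\mathcal X$ and every $g\in H^{m+2}_0(0,T;\mathcal X')$, there is a Galerkin semi-discrete solution $\phi_h\in H^m_0(0,T;\mathcal X)$; it is unique in this space (up to equality almost everywhere on $(0,T)$), and $$\|\phi_h\|_{H^m_0(0,T;\mathcal X)}\le c_T\,\|g\|_{H^{m+2}_0(0,T;\mathcal X')},\qquad c_T=\frac{c}{\alpha_{1/T}}.$$ Moreover, for every solution $\phi\in H^m_0(0,T;\mathcal X)$ of $A(\partial_t)\phi=g$ on $(0,T)$, $$\|\phi_h-\phi\|_{H^m_0(0,T;\mathcal X)}\le C_T\,\|\Pi_h\phi-\phi\|_{H^{m+4}_0(0,T;\mathcal X)},\qquad C_T=\frac{c\,M_{1/T}}{\alpha_{1/T}}.$$ -/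

import Mathlib

open MeasureTheory TemperedDistribution
open scoped ENNReal SchwartzMap ContDiff

namespace OperationalCalculus

noncomputable section

/-! ### The spaces `H^r_0(0,T;E)`, `r ≥ 0` -/

section Sobolev

variable {E : Type*} [NormedAddCommGroup E] [NormedSpace ℂ E] [CompleteSpace E]

/-- `G ∈ L²(ℝ;E)` belongs to `H^r(ℝ;E)`, with Bessel potential
`v = 𝓕⁻¹ (1 + ξ²)^{r/2} 𝓕 G ∈ L²(ℝ;E)` (so that `‖G‖_{H^r(ℝ;E)} = ‖v‖_{L²}`), it vanishes on
`(-∞,0)`, and its restriction to `(0,T)` is `g`. -/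
def IsCausalExtension (r T : ℝ) (g : ℝ → E) (G v : Lp E 2 (volume : Measure ℝ)) : Prop :=
  besselPotential ℝ E r (G : 𝓢'(ℝ, E)) = (v : 𝓢'(ℝ, E)) ∧
    (∀ᵐ t : ℝ, t < 0 → G t = 0) ∧
    (∀ᵐ t : ℝ, 0 < t → t < T → G t = g t)

/-- `g|_{(0,T)} ∈ H^r_0(0,T;E)`: it is the restriction to `(0,T)` of an element of `H^r(ℝ;E)` that
vanishes on `(-∞,0)`. Only the values of `g` on `(0,T)` matter. -/
def MemHZero (r T : ℝ) (g : ℝ → E) : Prop :=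
  ∃ G v : Lp E 2 (volume : Measure ℝ), IsCausalExtension r T g G v

/-- The natural (quotient) norm of `H^r_0(0,T;E)`: the infimum of `‖G‖_{H^r(ℝ;E)}` over all
extensions `G` of `g|_{(0,T)}` that vanish on `(-∞,0)`; it is `∞` if `g ∉ H^r_0(0,T;E)`. -/
def hZeroNorm (r T : ℝ) (g : ℝ → E) : ℝ≥0∞ :=
  ⨅ (G : Lp E 2 (volume : Measure ℝ)) (v : Lp E 2 (volume : Measure ℝ))
    (_ : IsCausalExtension r T g G v), ‖v‖ₑ

end Sobolev

/-! ### Temporal convolution operators `F(∂ₜ)` -/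

section Convolution

/-- The inverse Laplace transform (Bromwich integral along `Re s = 1`) of `F`. -/
def invLaplace {E : Type*} [NormedAddCommGroup E] [NormedSpace ℂ E] (F : ℂ → E) (t : ℝ) : E :=
  ((2 * Real.pi)⁻¹ : ℝ) •
    ∫ y : ℝ, Complex.exp ((1 + y * Complex.I) * t) • F (1 + y * Complex.I)

variable {E₁ E₂ : Type*} [NormedAddCommGroup E₁] [NormedSpace ℂ E₁]
  [NormedAddCommGroup E₂] [NormedSpace ℂ E₂]

/-- `(s^{-k} F)(∂ₜ) φ (t) = ∫₀ᵗ κ(t - τ) φ(τ) dτ`, `κ` the inverse Laplace transform of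
`s^{-k} F(s)`, which is a continuous function supported in `[0,∞)` if `F` is analytic on
`Re s > 0` and bounded by `M_σ |s|^μ` on each half-plane `Re s ≥ σ > 0`, with `μ < k - 1`.
It is `0` for `t ≤ 0`. -/
def integratedConv (k : ℕ) (F : ℂ → E₁ →L[ℂ] E₂) (φ : ℝ → E₁) (t : ℝ) : E₂ :=
  ∫ τ in Set.Ioc 0 t, invLaplace (fun s => (s ^ k)⁻¹ • F s) (t - τ) (φ τ)

/-- `F(∂ₜ) φ = (𝓛⁻¹F) * φ` as a distribution on `(-∞,T)`, evaluated at a test function `η`. The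
kernel `𝓛⁻¹F` is the `k`-th distributional derivative of `𝓛⁻¹(s^{-k}F)`, hence `F(∂ₜ) φ` is the
`k`-th distributional derivative of `(s^{-k}F)(∂ₜ) φ`. The function `φ` on `(0,T)` is extended by
zero to the negative half-axis. -/
def convDistribution (k : ℕ) (F : ℂ → E₁ →L[ℂ] E₂) (φ : ℝ → E₁) (η : ℝ → ℝ) : E₂ :=
  ((-1 : ℝ) ^ k) • ∫ t : ℝ, iteratedDeriv k η t • integratedConv k F φ t

/-- `η` is a test function on `(-∞,T)`. -/
def IsTestFunction (T : ℝ) (η : ℝ → ℝ) : Prop :=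
  ContDiff ℝ ∞ η ∧ HasCompactSupport η ∧ tsupport η ⊆ Set.Iio T

end Convolution

/-! ### The convolution equation and its Galerkin semi-discretization

The anti-dual `𝒳'` of `𝒳` is `X →L⋆[ℂ] ℂ` with the operator norm, and `⟨χ, f⟩ = f χ` is
anti-linear in `χ`. For `A(s)` of growth `|s|²` the power `k = 4 > 2 + 1` is used. -/

section Galerkin

variable {X : Type*} [NormedAddCommGroup X] [InnerProductSpace ℂ X]

/-- `A(∂ₜ) φ = g` on `(0,T)`, all functions being extended by zero to `(-∞,0)`. -/
def IsSolution (T : ℝ) (A : ℂ → X →L[ℂ] X →L⋆[ℂ] ℂ) (g : ℝ → X →L⋆[ℂ] ℂ) (φ : ℝ → X) : Prop :=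
  ∀ η : ℝ → ℝ, IsTestFunction T η →
    convDistribution 4 A φ η = ∫ t in Set.Ioi 0, η t • g t

/-- `φ` takes values in `Xh` and `⟨χ, A(∂ₜ) φ⟩ = ⟨χ, g⟩` on `(0,T)` for all `χ ∈ Xh`, all
functions being extended by zero to `(-∞,0)`. -/
def IsGalerkinSolution (T : ℝ) (A : ℂ → X →L[ℂ] X →L⋆[ℂ] ℂ) (Xh : Submodule ℂ X)
    (g : ℝ → X →L⋆[ℂ] ℂ) (φ : ℝ → X) : Prop :=
  (∀ᵐ t : ℝ, 0 < t → t < T → φ t ∈ Xh) ∧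
    ∀ χ ∈ Xh, ∀ η : ℝ → ℝ, IsTestFunction T η →
      convDistribution 4 A φ η χ = ∫ t in Set.Ioi 0, η t • g t χ

end Galerkin

end

end OperationalCalculus

/-! Multiplying functions on $(0,T)$ by $e^{-\sigma t}$ with $\sigma=1/T$ turns $A(\partial_t)$ into
the Fourier multiplier with symbol $A(s)$ on the line $\operatorname{Re}s=\sigma$. The weight costs
only the factor $e^{\sigma T}=e$, so pointwise bounds on that line become $L^2$ bounds by
Plancherel.

The second ingredient is causality. A symbol that is holomorphic and of polynomial growth on
$\operatorname{Re}s>\sigma_0$ yields a multiplier whose output before time $a$ depends only on the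
input before $a$ (`IsSymbol.vanishesBefore`), and multiplication by $e^{-\delta t}$ only moves the
line (`IsSymbol.isMul_exp_smul`). What happens after $T$ is therefore irrelevant. Sobolev regularity
is measured with $(1+s)^r$ in place of $(1+\xi^2)^{r/2}$: the two are comparable on
$\operatorname{Re}s=0$, but only the former is holomorphic, so that it and its inverse preserve
causality.

Identify $\mathcal X'$ with $\mathcal X$ by Riesz and let $P$ be the orthogonal projection onto
$\mathcal X_h$. Coercivity makes the compression of $A(s)$ to $\mathcal X_h$ invertible, and its
inverse $B(s)$ satisfies $\|B(s)\|\le|s|^2/\alpha_\sigma$, $PB=B=BP$, $PAB=P$, $BAP=P$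
(`exists_galerkinInverse`). Hence $\phi_h=B(\partial_t)g$, at the price of two derivatives. If
$A(\partial_t)\phi=g$, then $\phi_h-\phi=(I-BA)(\partial_t)(P\phi-\phi)$, since $(I-BA)P=0$; as
$\|I-BA\|\le1+|s|^4M_\sigma/\alpha_\sigma$, this costs four derivatives. Taking $s=\sigma$ in the
hypotheses gives $\alpha_\sigma\le\sigma^4M_\sigma$ on a nonzero space, so the summand $1$ is
absorbed into $M_\sigma/\alpha_\sigma$.

The distributional equations are brought into multiplier form by comparing $s^{-4}A\phi$ with
$s^{-4}g$: their difference vanishes for negative times, so no polynomial of degree three is left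
undetermined (`residual_eq_integral`, `vanishesBefore_of_forall_integral_eq_zero`). -/

namespace OperationalCalculus

noncomputable section

/-! ### The Fourier transform on `L²` and Fourier multipliers -/

section FourierLTwo

set_option linter.unusedSectionVars false

open FourierTransform Filter Topology

/-- Square integrable functions on the real line. -/
abbrev LTwo (E : Type*) [NormedAddCommGroup E] : Type _ := Lp E 2 (volume : Measure ℝ)

variable {E F G : Type*} [NormedAddCommGroup E] [InnerProductSpace ℂ E] [CompleteSpace E]
  [NormedAddCommGroup F] [InnerProductSpace ℂ F] [CompleteSpace F]
  [NormedAddCommGroup G] [InnerProductSpace ℂ G] [CompleteSpace G]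

theorem ae_eq_of_forall_integral_schwartz_smul_eq {V : Type*} [NormedAddCommGroup V]
    [NormedSpace ℂ V] [CompleteSpace V] {f g : ℝ → V} (hf : LocallyIntegrable f)
    (hg : LocallyIntegrable g)
    (h : ∀ φ : 𝓢(ℝ, ℂ), HasCompactSupport φ → ∫ x, φ x • f x = ∫ x, φ x • g x) :
    f =ᵐ[volume] g := by
  apply ae_eq_of_integral_contDiff_smul_eq hf hg
  intro η hη hηc
  have h1 : HasCompactSupport (Complex.ofRealCLM ∘ η) := hηc.comp_left rfl
  have h2 : ContDiff ℝ ∞ (Complex.ofRealCLM ∘ η) := by fun_prop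
  have := h (h1.toSchwartzMap h2) h1
  simpa using this

theorem LTwo.locallyIntegrable {V : Type*} [NormedAddCommGroup V] (w : LTwo V) :
    LocallyIntegrable w volume :=
  (Lp.memLp w).locallyIntegrable (by norm_num)

/-- The transform on $L^2$ is an abstract isometry; its agreement with the distributional one gives
the pairings from which pointwise information is recovered. -/
theorem integral_smul_fourier (w : LTwo E) (φ : 𝓢(ℝ, ℂ)) :
    ∫ ξ, φ ξ • (𝓕 w : LTwo E) ξ = ∫ t, (𝓕 φ) t • w t := by
  have h := congrArg (fun d => d φ) (Lp.fourier_toTemperedDistribution_eq w)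
  simpa [TemperedDistribution.fourier_apply] using h.symm

theorem integral_smul_fourierInv (w : LTwo E) (φ : 𝓢(ℝ, ℂ)) :
    ∫ ξ, φ ξ • (𝓕⁻ w : LTwo E) ξ = ∫ t, (𝓕⁻ φ) t • w t := by
  have h := congrArg (fun d => d φ) (Lp.fourierInv_toTemperedDistribution_eq w)
  simpa [TemperedDistribution.fourierInv_apply] using h.symm

theorem integral_fourier_smul_eq {f : ℝ → ℂ} {g : ℝ → E} (hf : Integrable f) (hg : Integrable g) :
    ∫ ξ, 𝓕 f ξ • g ξ = ∫ t, f t • 𝓕 g t := by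
  simpa using! (VectorFourier.integral_fourierIntegral_smul_eq_flip (L := innerₗ ℝ)
    Real.continuous_fourierChar continuous_inner hf hg)

theorem continuous_fourier {f : ℝ → E} (hf : Integrable f) : Continuous (𝓕 f) :=
  VectorFourier.fourierIntegral_continuous Real.continuous_fourierChar
    (by exact continuous_inner) hf

theorem fourier_ae_eq (w : LTwo E) (hw : Integrable w) :
    (𝓕 w : LTwo E) =ᵐ[volume] 𝓕 (w : ℝ → E) := by
  apply ae_eq_of_forall_integral_schwartz_smul_eq (LTwo.locallyIntegrable _)
    (continuous_fourier hw).locallyIntegrable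
  intro φ _
  rw [integral_smul_fourier, ← integral_fourier_smul_eq φ.integrable hw, SchwartzMap.fourier_coe]

theorem fourierInv_ae_eq (w : LTwo E) (hw : Integrable w) :
    (𝓕⁻ w : LTwo E) =ᵐ[volume] 𝓕⁻ (w : ℝ → E) := by
  have hc : Continuous (𝓕⁻ (w : ℝ → E)) := by
    rw [show 𝓕⁻ (w : ℝ → E) = fun t => 𝓕 (w : ℝ → E) (-t) from
      funext fun t => Real.fourierInv_eq_fourier_neg _ _]
    exact (continuous_fourier hw).comp continuous_neg
  apply ae_eq_of_forall_integral_schwartz_smul_eq (LTwo.locallyIntegrable _) hc.locallyIntegrable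
  intro φ _
  rw [integral_smul_fourierInv]
  have h1 : ∀ t, (𝓕⁻ φ) t = 𝓕 (φ : ℝ → ℂ) (-t) := fun t => by
    rw [← Real.fourierInv_eq_fourier_neg, SchwartzMap.fourierInv_coe]
  have h2 : ∀ t, 𝓕 (fun x => (w : ℝ → E) (-x)) t = 𝓕⁻ (w : ℝ → E) t := fun t => by
    rw [Real.fourierInv_eq_fourier_comp_neg]
  calc ∫ t, (𝓕⁻ φ) t • w t = ∫ t, 𝓕 (φ : ℝ → ℂ) t • (w : ℝ → E) (-t) := by
        rw [← integral_neg_eq_self]; simp [h1]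
    _ = ∫ t, φ t • 𝓕⁻ (w : ℝ → E) t := by
        rw [integral_fourier_smul_eq φ.integrable hw.comp_neg]; simp [h2]

/-- Pairings with Schwartz functions determine both sides, and `P` passes through the pairing
integrals. -/
theorem fourier_clm_apply (P : E →L[ℂ] F) {w : LTwo E} {z : LTwo F}
    (h : ∀ᵐ t, z t = P (w t)) : ∀ᵐ ξ, (𝓕 z : LTwo F) ξ = P ((𝓕 w : LTwo E) ξ) := by
  have h2 : (fun ξ => P ((𝓕 w : LTwo E) ξ)) =ᵐ[volume] P.compLp (𝓕 w : LTwo E) :=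
    EventuallyEq.symm (P.coeFn_compLp _)
  refine EventuallyEq.trans ?_ h2.symm
  apply ae_eq_of_forall_integral_schwartz_smul_eq (LTwo.locallyIntegrable _)
    (LTwo.locallyIntegrable _)
  intro φ _
  have key : ∀ (u : LTwo E) (ψ : 𝓢(ℝ, ℂ)), ∫ x, ψ x • P (u x) = P (∫ x, ψ x • u x) := by
    intro u ψ
    rw [← P.integral_comp_comm]
    · simp
    · exact memLp_one_iff_integrable.1 ((Lp.memLp u).smul (ψ.memLp 2 volume))
  calc ∫ x, φ x • (𝓕 z : LTwo F) x = ∫ t, (𝓕 φ) t • P (w t) := by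
        rw [integral_smul_fourier]
        exact integral_congr_ae (h.mono fun t ht => by simp only [ht])
    _ = ∫ x, φ x • P ((𝓕 w : LTwo E) x) := by
        rw [key, key, integral_smul_fourier]
    _ = _ := integral_congr_ae (h2.mono fun t ht => by simp only [ht])

theorem ae_eq_of_fourier_ae_eq {z z' : LTwo E}
    (h : (𝓕 z : LTwo E) =ᵐ[volume] (𝓕 z' : LTwo E)) : z = z' := by
  have := Lp.ext h
  exact (Lp.fourierTransformₗᵢ ℝ E).injective this

/-- A pointwise linear relation between `L²` functions is preserved by limits in `L²`. -/
theorem ae_clm_apply_of_tendsto {V W : Type*} [NormedAddCommGroup V] [NormedAddCommGroup W]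
    [NormedSpace ℂ V] [NormedSpace ℂ W]
    {w : ℕ → LTwo V} {z : ℕ → LTwo W} {w' : LTwo V} {z' : LTwo W}
    (c : ℕ → ℝ → V →L[ℂ] W) (c' : ℝ → V →L[ℂ] W)
    (hc : ∀ t, Tendsto (fun n => c n t) atTop (𝓝 (c' t)))
    (hw : Tendsto w atTop (𝓝 w')) (hz : Tendsto z atTop (𝓝 z'))
    (h : ∀ n, ∀ᵐ t, z n t = c n t (w n t)) : ∀ᵐ t, z' t = c' t (w' t) := by
  -- $L^2$ convergence gives almost everywhere convergence along a subsequence; the second one is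
  -- extracted from the first, so that both sequences converge along it.
  obtain ⟨ns, hns, hns'⟩ := (tendstoInMeasure_of_tendsto_Lp hw).exists_seq_tendsto_ae
  obtain ⟨ms, hms, hms'⟩ := (tendstoInMeasure_of_tendsto_Lp
    (hz.comp hns.tendsto_atTop)).exists_seq_tendsto_ae
  filter_upwards [hns', hms', ae_all_iff.2 h] with t h1 h2 h3
  have h4 : Tendsto (fun i => c (ns (ms i)) t (w (ns (ms i)) t)) atTop (𝓝 (c' t (w' t))) :=
    (isBoundedBilinearMap_apply.continuous.tendsto (c' t, w' t)).comp
      (((hc t).comp (hns.comp hms).tendsto_atTop).prodMk_nhds (h1.comp hms.tendsto_atTop))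
  refine tendsto_nhds_unique (h2.congr fun i => ?_) h4
  exact h3 _

/-- Dominated convergence, with majorant $(2\|w'\|)^2$. It serves both for truncation in time and
for damping in frequency. -/
theorem tendsto_of_ae_eq_smul {V : Type*} [NormedAddCommGroup V] [NormedSpace ℂ V]
    {w : ℕ → LTwo V} {w' : LTwo V} (c : ℕ → ℝ → ℂ) (hb : ∀ n t, ‖c n t‖ ≤ 1)
    (hc : ∀ t, Tendsto (fun n => c n t) atTop (𝓝 1))
    (h : ∀ n, ∀ᵐ t, w n t = c n t • w' t) : Tendsto w atTop (𝓝 w') := by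
  rw [Lp.tendsto_Lp_iff_tendsto_eLpNorm']
  have e : ∀ n, eLpNorm (⇑(w n) - ⇑w') 2 volume
      = (∫⁻ t, ‖(c n t - 1) • w' t‖ₑ ^ (2 : ℝ)) ^ (1 / 2 : ℝ) := by
    intro n
    rw [eLpNorm_eq_lintegral_rpow_enorm_toReal (by norm_num) (by norm_num)]
    simp only [ENNReal.toReal_ofNat]
    congr 1
    refine lintegral_congr_ae ((h n).mono fun t ht => ?_)
    simp only [Pi.sub_apply, ht, sub_smul, one_smul]
  simp only [e]
  have hlim : Tendsto (fun n => ∫⁻ t, ‖(c n t - 1) • w' t‖ₑ ^ (2 : ℝ)) atTop (𝓝 0) := by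
    rw [show (0 : ℝ≥0∞) = ∫⁻ _ : ℝ, 0 by simp]
    apply tendsto_lintegral_of_dominated_convergence' (fun t => (2 * ‖w' t‖ₑ) ^ (2 : ℝ))
    · intro n
      have : AEStronglyMeasurable (fun t => (c n t - 1) • w' t) volume := by
        refine ((Lp.aestronglyMeasurable (w n)).sub (Lp.aestronglyMeasurable w')).congr
          ((h n).mono fun t ht => ?_)
        simp only [Pi.sub_apply, ht, sub_smul, one_smul]
      exact this.enorm.pow_const _
    · intro n
      refine Eventually.of_forall fun t => ?_
      dsimp only
      gcongr
      rw [enorm_smul]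
      gcongr
      rw [← ofReal_norm, ← ENNReal.ofReal_ofNat]
      apply ENNReal.ofReal_le_ofReal
      calc ‖c n t - 1‖ ≤ ‖c n t‖ + ‖(1 : ℂ)‖ := norm_sub_le _ _
        _ ≤ 2 := by rw [norm_one]; linarith [hb n t]
    · have h1 := (Lp.memLp w').eLpNorm_lt_top
      rw [eLpNorm_eq_lintegral_rpow_enorm_toReal (by norm_num) (by norm_num)] at h1
      simp only [ENNReal.toReal_ofNat] at h1
      have h2 := (ENNReal.rpow_lt_top_iff_of_pos (by norm_num : (0:ℝ) < 1 / 2)).1 h1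
      simp only [ENNReal.mul_rpow_of_nonneg _ _ (by norm_num : (0:ℝ) ≤ 2)]
      rw [lintegral_const_mul' _ _ (by simp)]
      exact ENNReal.mul_ne_top (by simp) h2.ne
    · refine Eventually.of_forall fun t => ?_
      have : Tendsto (fun n => ‖(c n t - 1) • w' t‖ₑ) atTop (𝓝 ‖((1 : ℂ) - 1) • w' t‖ₑ) :=
        (((hc t).sub_const 1).smul_const _).enorm
      simp only [sub_self, zero_smul, enorm_zero] at this
      have h2 := (ENNReal.continuous_rpow_const (y := (2 : ℝ))).tendsto 0 |>.comp this
      simpa [Function.comp_def] using h2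
  have := (ENNReal.continuous_rpow_const (y := (1 / 2 : ℝ))).tendsto 0 |>.comp hlim
  simpa [Function.comp_def] using this

/-- The point of the vertical line `Re s = σ` with frequency `ξ`. -/
def line (σ ξ : ℝ) : ℂ := σ + (2 * Real.pi * ξ : ℝ) * Complex.I

@[simp] theorem line_re (σ ξ : ℝ) : (line σ ξ).re = σ := by simp [line]

@[simp] theorem line_im (σ ξ : ℝ) : (line σ ξ).im = 2 * Real.pi * ξ := by simp [line]

theorem continuous_line (σ : ℝ) : Continuous (line σ) := by unfold line; fun_prop

/-- `z` is obtained from `w` by the Fourier multiplier with symbol `S` on the line `Re s = σ`. -/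
def IsMul (σ : ℝ) (S : ℂ → E →L[ℂ] F) (w : LTwo E) (z : LTwo F) : Prop :=
  ∀ᵐ ξ : ℝ, (𝓕 z : LTwo F) ξ = S (line σ ξ) ((𝓕 w : LTwo E) ξ)

variable {σ : ℝ} {S S' : ℂ → E →L[ℂ] F}

theorem IsMul.comp {S₂ : ℂ → F →L[ℂ] G} {w : LTwo E} {z : LTwo F} {y : LTwo G}
    (h : IsMul σ S w z) (h2 : IsMul σ S₂ z y) : IsMul σ (fun s => S₂ s ∘L S s) w y := by
  filter_upwards [h, h2] with ξ h1 h2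
  simp [h2, h1]

theorem IsMul.congr {w : LTwo E} {z : LTwo F} (h : IsMul σ S w z)
    (h2 : ∀ s, s.re = σ → S s = S' s) : IsMul σ S' w z := by
  filter_upwards [h] with ξ h1
  rw [h1, h2 _ (line_re _ _)]

theorem IsMul.unique {w : LTwo E} {z z' : LTwo F} (h : IsMul σ S w z) (h' : IsMul σ S w z') :
    z = z' := by
  apply ae_eq_of_fourier_ae_eq
  filter_upwards [h, h'] with ξ h1 h2
  rw [h1, h2]

theorem isMul_const {P : E →L[ℂ] F} {w : LTwo E} {z : LTwo F} (h : ∀ᵐ t, z t = P (w t)) :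
    IsMul σ (fun _ => P) w z := fourier_clm_apply P h

theorem fourier_lp_sub (z z' : LTwo F) :
    (𝓕 (z - z') : LTwo F) =ᵐ[volume] fun ξ => (𝓕 z : LTwo F) ξ - (𝓕 z' : LTwo F) ξ := by
  rw [show (𝓕 (z - z') : LTwo F) = 𝓕 z - 𝓕 z' from (Lp.fourierTransformₗᵢ ℝ F).map_sub z z']
  exact Lp.coeFn_sub _ _

theorem IsMul.sub {w w' : LTwo E} {z z' : LTwo F} (h : IsMul σ S w z) (h' : IsMul σ S w' z') :
    IsMul σ S (w - w') (z - z') := by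
  filter_upwards [h, h', fourier_lp_sub z z', fourier_lp_sub w w'] with ξ h1 h2 h3 h4
  rw [h3, h4, h1, h2, map_sub]

/-- Symbols: holomorphic functions of polynomial growth on an open half-plane. -/
structure IsSymbol (σ₀ : ℝ) (S : ℂ → E →L[ℂ] F) : Prop where
  differentiableOn : DifferentiableOn ℂ S {s | σ₀ < s.re}
  growth : ∃ (C : ℝ) (N : ℕ), 0 ≤ C ∧ ∀ s : ℂ, σ₀ < s.re → ‖S s‖ ≤ C * (1 + ‖s‖) ^ N

theorem IsSymbol.continuous_line {σ₀ : ℝ} (h : IsSymbol σ₀ S) (hσ : σ₀ < σ) :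
    Continuous fun ξ => S (line σ ξ) := by
  refine h.differentiableOn.continuousOn.comp_continuous (OperationalCalculus.continuous_line σ)
    fun ξ => ?_
  simpa using hσ

theorem IsSymbol.exists_isMul {σ₀ : ℝ} (h : IsSymbol σ₀ S) (hσ : σ₀ < σ) {K : ℝ}
    (hK : ∀ s : ℂ, s.re = σ → ‖S s‖ ≤ K) (w : LTwo E) :
    ∃ z : LTwo F, IsMul σ S w z ∧ ‖z‖ ≤ K * ‖w‖ := by
  have hb : ∀ᵐ ξ, ‖S (line σ ξ) ((𝓕 w : LTwo E) ξ)‖ ≤ K * ‖(𝓕 w : LTwo E) ξ‖ :=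
    Eventually.of_forall fun ξ => (S _).le_of_opNorm_le (hK _ (line_re _ _)) _
  have hm : MemLp (fun ξ => S (line σ ξ) ((𝓕 w : LTwo E) ξ)) 2 volume :=
    (Lp.memLp (𝓕 w : LTwo E)).of_le_mul
      (isBoundedBilinearMap_apply.continuous.comp_aestronglyMeasurable
        ((h.continuous_line hσ).aestronglyMeasurable.prodMk (Lp.aestronglyMeasurable _))) hb
  have hF : (𝓕 (𝓕⁻ (hm.toLp _) : LTwo F) : LTwo F) = hm.toLp _ := fourier_fourierInv_eq _
  refine ⟨𝓕⁻ (hm.toLp _), ?_, ?_⟩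
  · unfold IsMul
    rw [hF]
    exact hm.coeFn_toLp
  · rw [← Lp.norm_fourier_eq, hF, ← Lp.norm_fourier_eq w]
    apply Lp.norm_le_mul_norm_of_ae_le_mul
    filter_upwards [hm.coeFn_toLp, hb] with ξ h1 h2
    rwa [h1]

theorem IsSymbol.comp {σ₀ : ℝ} {S₂ : ℂ → F →L[ℂ] G} (h2 : IsSymbol σ₀ S₂) (h : IsSymbol σ₀ S) :
    IsSymbol σ₀ (fun s => S₂ s ∘L S s) := by
  obtain ⟨C, N, hC, h'⟩ := h.growth
  obtain ⟨C₂, N₂, hC₂, h2'⟩ := h2.growth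
  refine ⟨h2.differentiableOn.clm_comp h.differentiableOn, C₂ * C, N₂ + N, by positivity,
    fun s hs => ?_⟩
  calc ‖S₂ s ∘L S s‖ ≤ ‖S₂ s‖ * ‖S s‖ := ContinuousLinearMap.opNorm_comp_le _ _
    _ ≤ (C₂ * (1 + ‖s‖) ^ N₂) * (C * (1 + ‖s‖) ^ N) := by
        gcongr
        exacts [h2' s hs, h' s hs]
    _ = C₂ * C * (1 + ‖s‖) ^ (N₂ + N) := by ring

theorem IsSymbol.smul {σ₀ : ℝ} (h : IsSymbol σ₀ S) {c : ℂ → ℂ}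
    (hc : DifferentiableOn ℂ c {s | σ₀ < s.re})
    (hg : ∃ (C : ℝ) (N : ℕ), 0 ≤ C ∧ ∀ s : ℂ, σ₀ < s.re → ‖c s‖ ≤ C * (1 + ‖s‖) ^ N) :
    IsSymbol σ₀ (fun s => c s • S s) := by
  obtain ⟨C, N, hC, h'⟩ := h.growth
  obtain ⟨C₂, N₂, hC₂, h2'⟩ := hg
  refine ⟨hc.smul h.differentiableOn, C₂ * C, N₂ + N, by positivity, fun s hs => ?_⟩
  calc ‖c s • S s‖ = ‖c s‖ * ‖S s‖ := norm_smul _ _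
    _ ≤ (C₂ * (1 + ‖s‖) ^ N₂) * (C * (1 + ‖s‖) ^ N) := by
        gcongr
        exacts [h2' s hs, h' s hs]
    _ = C₂ * C * (1 + ‖s‖) ^ (N₂ + N) := by ring

theorem isSymbol_const (σ₀ : ℝ) (P : E →L[ℂ] F) : IsSymbol σ₀ (fun _ => P) :=
  ⟨differentiableOn_const _, ‖P‖, 0, norm_nonneg _, by simp⟩

theorem IsSymbol.sub {σ₀ : ℝ} (h : IsSymbol σ₀ S) (h' : IsSymbol σ₀ S') :
    IsSymbol σ₀ (fun s => S s - S' s) := by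
  obtain ⟨C, N, hC, hS⟩ := h.growth
  obtain ⟨C₂, N₂, hC₂, hS'⟩ := h'.growth
  refine ⟨h.differentiableOn.sub h'.differentiableOn, C + C₂, N + N₂, by positivity,
    fun s hs => ?_⟩
  have h1 : (1 : ℝ) ≤ 1 + ‖s‖ := by linarith [norm_nonneg s]
  calc ‖S s - S' s‖ ≤ ‖S s‖ + ‖S' s‖ := norm_sub_le _ _
    _ ≤ C * (1 + ‖s‖) ^ N + C₂ * (1 + ‖s‖) ^ N₂ := add_le_add (hS s hs) (hS' s hs)
    _ ≤ C * (1 + ‖s‖) ^ (N + N₂) + C₂ * (1 + ‖s‖) ^ (N + N₂) := by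
        gcongr <;> first | exact h1 | omega
    _ = _ := by ring

end FourierLTwo

/-! ### Contour shifts and convolution kernels -/

section Kernel

set_option linter.unusedSectionVars false

open FourierTransform Filter Topology

/-- Cauchy's theorem on the rectangles $[\sigma_1,\sigma_2]\times[-n,n]$: the horizontal sides
contribute $O((1+n^2)^{-1})$. -/
theorem integral_vertical_eq {V : Type*} [NormedAddCommGroup V] [NormedSpace ℂ V]
    [CompleteSpace V] {H : ℂ → V} {σ₁ σ₂ C : ℝ} (h12 : σ₁ ≤ σ₂)
    (hd : DifferentiableOn ℂ H {s | σ₁ ≤ s.re})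
    (hC : ∀ s : ℂ, σ₁ ≤ s.re → s.re ≤ σ₂ → ‖H s‖ ≤ C * (1 + s.im ^ 2)⁻¹) :
    ∫ y : ℝ, H (σ₁ + y * Complex.I) = ∫ y : ℝ, H (σ₂ + y * Complex.I) := by
  have hint : ∀ σ : ℝ, σ₁ ≤ σ → σ ≤ σ₂ → Integrable fun y : ℝ => H (σ + y * Complex.I) := by
    intro σ h1 h2
    refine (integrable_inv_one_add_sq.const_mul C).mono' ?_ ?_
    · refine (hd.continuousOn.comp_continuous (f := fun y : ℝ => (σ : ℂ) + y * Complex.I)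
        (by fun_prop) fun y => ?_).aestronglyMeasurable
      simpa using h1
    · refine Eventually.of_forall fun y => ?_
      simpa using hC (σ + y * Complex.I) (by simpa using h1) (by simpa using h2)
  have hlim : ∀ σ : ℝ, σ₁ ≤ σ → σ ≤ σ₂ → Tendsto
      (fun n : ℕ => ∫ y in (-(n : ℝ))..n, H (σ + y * Complex.I)) atTop
      (𝓝 (∫ y : ℝ, H (σ + y * Complex.I))) := fun σ h1 h2 =>
    intervalIntegral_tendsto_integral (hint σ h1 h2)
      (tendsto_neg_atTop_atBot.comp tendsto_natCast_atTop_atTop) tendsto_natCast_atTop_atTop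
  -- The sign $e=\pm1$ covers the upper and the lower side at once.
  have hside : ∀ e : ℝ, e ^ 2 = 1 → Tendsto
      (fun n : ℕ => ∫ x in σ₁..σ₂, H (x + ((e * n : ℝ) : ℂ) * Complex.I)) atTop (𝓝 0) := by
    intro e he
    have hz : Tendsto (fun n : ℕ => C * (1 + (n : ℝ) ^ 2)⁻¹ * |σ₂ - σ₁|) atTop (𝓝 0) := by
      have : Tendsto (fun n : ℕ => (1 + (n : ℝ) ^ 2)⁻¹) atTop (𝓝 0) := by
        apply tendsto_inv_atTop_zero.comp
        apply tendsto_atTop_add_const_left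
        exact (tendsto_pow_atTop (by norm_num)).comp tendsto_natCast_atTop_atTop
      simpa using (this.const_mul C).mul_const |σ₂ - σ₁|
    refine squeeze_zero_norm (fun n => ?_) hz
    apply intervalIntegral.norm_integral_le_of_norm_le_const
    intro x hx
    rw [Set.uIoc_of_le h12] at hx
    have := hC (x + ((e * n : ℝ) : ℂ) * Complex.I) (by simpa using hx.1.le) (by simpa using hx.2)
    simpa [mul_pow, he] using this
  have hrect : ∀ n : ℕ, (∫ x in σ₁..σ₂, H (x + (((-1) * n : ℝ) : ℂ) * Complex.I))
      - (∫ x in σ₁..σ₂, H (x + ((1 * n : ℝ) : ℂ) * Complex.I))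
      + Complex.I • (∫ y in (-(n : ℝ))..n, H (σ₂ + y * Complex.I))
      - Complex.I • (∫ y in (-(n : ℝ))..n, H (σ₁ + y * Complex.I)) = 0 := by
    intro n
    have := Complex.integral_boundary_rect_eq_zero_of_differentiableOn H ⟨σ₁, -n⟩ ⟨σ₂, n⟩ ?_
    · simpa using this
    · refine hd.mono fun s hs => ?_
      have := (Complex.mem_reProdIm.1 hs).1
      rw [Set.uIcc_of_le h12] at this
      exact this.1
  have hl := (((hside (-1) (by norm_num)).sub (hside 1 (by norm_num))).add
    ((hlim σ₂ h12 le_rfl).const_smul Complex.I)).sub ((hlim σ₁ le_rfl h12).const_smul Complex.I)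
  have h0 := tendsto_nhds_unique (hl.congr hrect) tendsto_const_nhds
  rw [sub_zero, zero_add, ← smul_sub, smul_eq_zero, sub_eq_zero] at h0
  exact (h0.resolve_left Complex.I_ne_zero).symm

theorem integral_line {V : Type*} [NormedAddCommGroup V] [NormedSpace ℂ V] (H : ℂ → V) (σ : ℝ) :
    ∫ ξ : ℝ, H (line σ ξ) = ((2 * Real.pi)⁻¹ : ℝ) • ∫ y : ℝ, H (σ + y * Complex.I) := by
  have := Measure.integral_comp_mul_left (fun y : ℝ => H (σ + y * Complex.I)) (2 * Real.pi)
  rw [abs_of_pos (by positivity)] at this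
  exact this

variable {E F : Type*} [NormedAddCommGroup E] [NormedAddCommGroup F]

/-- Holomorphic functions on a half-plane with quadratic decay along vertical lines. -/
structure IsDecaying {V : Type*} [NormedAddCommGroup V] [NormedSpace ℂ V]
    (σ₀ : ℝ) (S : ℂ → V) : Prop where
  differentiableOn : DifferentiableOn ℂ S {s | σ₀ < s.re}
  decay : ∃ C : ℝ, 0 ≤ C ∧ ∀ s : ℂ, σ₀ < s.re → ‖S s‖ ≤ C * (1 + s.im ^ 2)⁻¹

/-- The inverse Laplace transform along the line `Re s = σ`. -/
def lineKernel {V : Type*} [NormedAddCommGroup V] [NormedSpace ℂ V]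
    (σ : ℝ) (S : ℂ → V) (t : ℝ) : V :=
  ∫ ξ : ℝ, Complex.exp (line σ ξ * t) • S (line σ ξ)

theorem invLaplace_eq_lineKernel {V : Type*} [NormedAddCommGroup V] [NormedSpace ℂ V]
    (S : ℂ → V) (t : ℝ) : invLaplace S t = lineKernel 1 S t := by
  rw [lineKernel, integral_line (fun s => Complex.exp (s * t) • S s), invLaplace]
  norm_num

namespace IsDecaying

variable {V : Type*} [NormedAddCommGroup V] [NormedSpace ℂ V] [CompleteSpace V]
  {σ₀ : ℝ} {S : ℂ → V}

theorem continuous_line (h : IsDecaying σ₀ S) {σ : ℝ} (hσ : σ₀ < σ) :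
    Continuous fun ξ => S (line σ ξ) := by
  refine h.differentiableOn.continuousOn.comp_continuous (OperationalCalculus.continuous_line σ)
    fun ξ => ?_
  simpa using hσ

theorem integrable_line (h : IsDecaying σ₀ S) {σ : ℝ} (hσ : σ₀ < σ) :
    Integrable fun ξ => S (line σ ξ) := by
  obtain ⟨C, hC0, hC⟩ := h.decay
  have h1 : Integrable fun ξ : ℝ => C * (1 + (2 * Real.pi * ξ) ^ 2)⁻¹ :=
    ((integrable_inv_one_add_sq).comp_mul_left'
      (by positivity : 2 * Real.pi ≠ 0)).const_mul C
  refine h1.mono' (h.continuous_line hσ).aestronglyMeasurable (Eventually.of_forall fun ξ => ?_)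
  simpa using hC (line σ ξ) (by simpa using hσ)

theorem integrable_exp_smul_line (h : IsDecaying σ₀ S) {σ : ℝ} (hσ : σ₀ < σ) (t : ℝ) :
    Integrable fun ξ => Complex.exp (line σ ξ * t) • S (line σ ξ) := by
  refine (h.integrable_line hσ).bdd_smul (Real.exp (σ * t)) ?_ ?_
  · have := OperationalCalculus.continuous_line σ
    exact Continuous.aestronglyMeasurable (by fun_prop)
  · refine Eventually.of_forall fun ξ => ?_
    rw [Complex.norm_exp]; simp

theorem lineKernel_eq_of_le (h : IsDecaying σ₀ S) {σ₁ σ₂ : ℝ} (h1 : σ₀ < σ₁) (h2 : σ₁ ≤ σ₂)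
    (t : ℝ) : lineKernel σ₁ S t = lineKernel σ₂ S t := by
  obtain ⟨C, hC0, hC⟩ := h.decay
  rw [lineKernel, lineKernel, integral_line (fun s => Complex.exp (s * t) • S s),
    integral_line (fun s => Complex.exp (s * t) • S s)]
  congr 1
  -- This constant bounds $|e^{st}|$ on the strip for either sign of $t$.
  apply integral_vertical_eq (H := fun s => Complex.exp (s * t) • S s) (C := Real.exp (|σ₁ * t| + |σ₂ * t|) * C) h2
  · apply DifferentiableOn.smul (by fun_prop)
    exact h.differentiableOn.mono fun s (hs : σ₁ ≤ s.re) => lt_of_lt_of_le h1 hs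
  · intro s hs1 hs2
    rw [norm_smul, Complex.norm_exp, mul_assoc]
    gcongr
    · have : s.re * t ≤ |σ₁ * t| + |σ₂ * t| := by
        rcases le_total 0 t with ht | ht
        · have := mul_le_mul_of_nonneg_right hs2 ht
          linarith [le_abs_self (σ₂ * t), abs_nonneg (σ₁ * t)]
        · have := mul_le_mul_of_nonpos_right hs1 ht
          linarith [le_abs_self (σ₁ * t), abs_nonneg (σ₂ * t)]
      simpa using this
    · exact hC s (h1.trans_le hs1)

theorem lineKernel_eq (h : IsDecaying σ₀ S) {σ₁ σ₂ : ℝ} (h1 : σ₀ < σ₁) (h2 : σ₀ < σ₂) (t : ℝ) :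
    lineKernel σ₁ S t = lineKernel σ₂ S t := by
  rcases le_total σ₁ σ₂ with h | h
  · exact IsDecaying.lineKernel_eq_of_le ‹_› h1 h t
  · exact (IsDecaying.lineKernel_eq_of_le ‹_› h2 h t).symm

/-- The source of causality: the line may be pushed to the right, where $|e^{st}|=e^{\sigma't}\to0$
for $t<0$, while the integral of the decay bound does not depend on $\sigma'$. -/
theorem lineKernel_of_neg (h : IsDecaying σ₀ S) {σ : ℝ} (hσ : σ₀ < σ) {t : ℝ} (ht : t < 0) :
    lineKernel σ S t = 0 := by
  obtain ⟨C, hC0, hC⟩ := h.decay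
  set K := ∫ ξ : ℝ, C * (1 + (2 * Real.pi * ξ) ^ 2)⁻¹
  have hb : ∀ σ', σ ≤ σ' → ‖lineKernel σ S t‖ ≤ Real.exp (σ' * t) * K := by
    intro σ' h'
    rw [h.lineKernel_eq_of_le hσ h', lineKernel, ← integral_const_mul]
    apply norm_integral_le_of_norm_le
    · exact (((integrable_inv_one_add_sq).comp_mul_left'
        (by positivity : 2 * Real.pi ≠ 0)).const_mul C).const_mul _
    · refine Eventually.of_forall fun ξ => ?_
      rw [norm_smul, Complex.norm_exp]
      have := hC (line σ' ξ) (by simpa using hσ.trans_le h')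
      simp only [line_im] at this
      simp only [Complex.mul_re, line_re, Complex.ofReal_re, Complex.ofReal_im, mul_zero, sub_zero]
      gcongr
  have hl : Tendsto (fun σ' : ℝ => Real.exp (σ' * t) * K) atTop (𝓝 0) := by
    have : Tendsto (fun σ' : ℝ => Real.exp (σ' * t)) atTop (𝓝 0) :=
      Real.tendsto_exp_atBot.comp (tendsto_id.atTop_mul_const_of_neg ht)
    simpa using this.mul_const K
  have := ge_of_tendsto hl ((eventually_ge_atTop σ).mono hb)
  exact norm_le_zero_iff.1 this

end IsDecaying

variable [InnerProductSpace ℂ E] [CompleteSpace E] [InnerProductSpace ℂ F] [CompleteSpace F]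

/-- Fourier inversion and Fubini. The factor $e^{-\sigma(t-\tau)}$ compensates the real part of $s$
in the $e^{st}$ of `lineKernel`, which the Fourier transform does not contain. -/
theorem IsMul.ae_eq_integral_lineKernel {σ₀ σ : ℝ} {S : ℂ → E →L[ℂ] F} (hS : IsDecaying σ₀ S)
    (hσ : σ₀ < σ) {w : LTwo E} {z : LTwo F} (h : IsMul σ S w z) (hw : Integrable w) :
    ∀ᵐ t, z t = ∫ τ, Complex.exp (-(σ * (t - τ) : ℝ)) • lineKernel σ S (t - τ) (w τ) := by
  have hz : (𝓕 z : LTwo F) =ᵐ[volume] fun ξ => S (line σ ξ) (𝓕 (w : ℝ → E) ξ) := by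
    filter_upwards [h, fourier_ae_eq w hw] with ξ h1 h2
    rw [h1, h2]
  have hbd : ∀ ξ, ‖𝓕 (w : ℝ → E) ξ‖ ≤ ∫ τ, ‖w τ‖ := fun ξ =>
    VectorFourier.norm_fourierIntegral_le_integral_norm _ _ _ _ _
  have hint : Integrable fun ξ => S (line σ ξ) (𝓕 (w : ℝ → E) ξ) := by
    refine ((hS.integrable_line hσ).norm.mul_const (∫ τ, ‖w τ‖)).mono' ?_ ?_
    · exact ((hS.continuous_line hσ).clm_apply (continuous_fourier hw)).aestronglyMeasurable
    · exact Eventually.of_forall fun ξ => (S _).le_opNorm_of_le (hbd ξ)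
  have h3 := fourierInv_ae_eq (𝓕 z) (hint.congr hz.symm)
  rw [show (𝓕⁻ (𝓕 z : LTwo F) : LTwo F) = z from fourierInv_fourier_eq z] at h3
  filter_upwards [h3] with t ht
  rw [ht, Real.fourierInv_eq' ]
  have hprod : Integrable (fun p : ℝ × ℝ =>
      Complex.exp (2 * Real.pi * p.1 * (t - p.2) * Complex.I) • S (line σ p.1) (w p.2))
      (volume.prod volume) := by
    have h1 : Integrable (fun p : ℝ × ℝ => ‖S (line σ p.1)‖ * ‖w p.2‖) (volume.prod volume) :=
      (hS.integrable_line hσ).norm.mul_prod hw.norm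
    refine h1.mono' ?_ ?_
    · refine AEStronglyMeasurable.smul (Continuous.aestronglyMeasurable (by fun_prop)) ?_
      exact isBoundedBilinearMap_apply.continuous.comp_aestronglyMeasurable
        (((hS.continuous_line hσ).comp continuous_fst).aestronglyMeasurable.prodMk
          hw.aestronglyMeasurable.comp_snd)
    · refine Eventually.of_forall fun p => ?_
      have : (2 * Real.pi * p.1 * (t - p.2) * Complex.I : ℂ)
        = ((2 * Real.pi * p.1 * (t - p.2) : ℝ) : ℂ) * Complex.I := by push_cast; ring
      rw [norm_smul, this, Complex.norm_exp_ofReal_mul_I, one_mul]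
      exact (S _).le_opNorm _
  have e1 : ∀ᵐ ξ, Complex.exp (((2 * Real.pi * inner ℝ ξ t : ℝ) : ℂ) * Complex.I) •
      (𝓕 z : LTwo F) ξ
      = ∫ τ : ℝ, Complex.exp (2 * Real.pi * ξ * (t - τ) * Complex.I) • S (line σ ξ) (w τ) := by
    filter_upwards [hz] with ξ hξ
    rw [hξ, Real.fourier_eq', ← ContinuousLinearMap.integral_comp_comm, ← integral_smul]
    · refine integral_congr_ae (Eventually.of_forall fun τ => ?_)
      simp only [map_smul, smul_smul, ← Complex.exp_add]
      congr 2
      simp only [RCLike.inner_apply, conj_trivial]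
      push_cast
      ring
    · refine hw.bdd_smul 1 (Continuous.aestronglyMeasurable (by fun_prop)) ?_
      refine Eventually.of_forall fun τ => ?_
      rw [Complex.norm_exp_ofReal_mul_I]
  rw [integral_congr_ae e1, integral_integral_swap hprod]
  refine integral_congr_ae (Eventually.of_forall fun τ => ?_)
  simp only
  rw [lineKernel, ContinuousLinearMap.integral_apply (hS.integrable_exp_smul_line hσ _),
    ← integral_smul]
  refine integral_congr_ae (Eventually.of_forall fun ξ => ?_)
  simp only [smul_apply, smul_smul, ← Complex.exp_add]
  congr 2
  simp only [line]
  push_cast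
  ring

end Kernel

/-! ### Causality, and change of the line of integration -/

section Causality

set_option linter.unusedSectionVars false

open FourierTransform Filter Topology

/-- The bound concerns the product and not `c`, so that weights like $e^{-\delta t}$, unbounded for
$t<0$, may act on functions vanishing there. -/
theorem LTwo.exists_smul {V : Type*} [NormedAddCommGroup V] [NormedSpace ℂ V] (w : LTwo V)
    {c : ℝ → ℂ} (hc : Measurable c) {K : ℝ} (hb : ∀ᵐ t, ‖c t • w t‖ ≤ K * ‖w t‖) :
    ∃ w' : LTwo V, (∀ᵐ t, w' t = c t • w t) ∧ ‖w'‖ ≤ K * ‖w‖ := by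
  have hm : MemLp (fun t => c t • w t) 2 volume := (Lp.memLp w).of_le_mul
    (hc.aestronglyMeasurable.smul (Lp.aestronglyMeasurable w)) hb
  refine ⟨hm.toLp _, hm.coeFn_toLp, ?_⟩
  apply Lp.norm_le_mul_norm_of_ae_le_mul
  filter_upwards [hm.coeFn_toLp, hb] with t h1 h2
  rwa [h1]

/-- `z` vanishes almost everywhere on `(-∞, a)`. -/
def VanishesBefore {V : Type*} [NormedAddCommGroup V] (a : ℝ) (z : LTwo V) : Prop :=
  ∀ᵐ t : ℝ, t < a → z t = 0

theorem VanishesBefore.of_tendsto {V : Type*} [NormedAddCommGroup V] [NormedSpace ℂ V] {a : ℝ}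
    {z : ℕ → LTwo V} {z' : LTwo V} (hz : Tendsto z atTop (𝓝 z'))
    (h : ∀ n, VanishesBefore a (z n)) : VanishesBefore a z' := by
  classical
  -- Vanishing before $a$ is the pointwise linear relation $z=1_{[a,\infty)}z$, hence stable under
  -- $L^2$ limits.
  let c : ℝ → V →L[ℂ] V := fun t => if t < a then 0 else ContinuousLinearMap.id ℂ V
  have := ae_clm_apply_of_tendsto (fun _ => c) c (fun t => tendsto_const_nhds) hz hz (fun n => by
    filter_upwards [h n] with t ht
    by_cases hta : t < a
    · simp [c, hta, ht hta]
    · simp [c, hta])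
  filter_upwards [this] with t ht hta
  rw [ht]
  simp [c, hta]

variable {E F : Type*} [NormedAddCommGroup E] [InnerProductSpace ℂ E] [CompleteSpace E]
  [NormedAddCommGroup F] [InnerProductSpace ℂ F] [CompleteSpace F]
  {σ₀ σ : ℝ} {S : ℂ → E →L[ℂ] F}

namespace IsDecaying

theorem isSymbol (hS : IsDecaying σ₀ S) : IsSymbol σ₀ S := by
  obtain ⟨C, hC0, hC⟩ := hS.decay
  refine ⟨hS.differentiableOn, C, 0, hC0, fun s hs => (hC s hs).trans ?_⟩
  rw [pow_zero]
  gcongr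
  exact inv_le_one_of_one_le₀ (by nlinarith [sq_nonneg s.im])

theorem vanishesBefore_of_integrable (hS : IsDecaying σ₀ S) (hσ : σ₀ < σ) {w : LTwo E}
    {z : LTwo F} (h : IsMul σ S w z) (hw : Integrable w) {a : ℝ} (ha : VanishesBefore a w) :
    VanishesBefore a z := by
  filter_upwards [h.ae_eq_integral_lineKernel hS hσ hw] with t ht hta
  rw [ht]
  refine integral_eq_zero_of_ae ?_
  filter_upwards [ha] with τ hτ
  rcases lt_or_ge τ a with h1 | h1
  · simp [hτ h1]
  · simp [hS.lineKernel_of_neg hσ (show t - τ < 0 by linarith)]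

/-- The kernel is the same for all lines, and in $e^{-(\sigma+\delta)(t-\tau)}=e^{-\delta
t}e^{\delta\tau}e^{-\sigma(t-\tau)}$ the factor $e^{\delta\tau}$ cancels the weight of `w'`. -/
theorem exp_smul_of_integrable (hS : IsDecaying σ₀ S) (hσ : σ₀ < σ) {δ : ℝ} (hδ : 0 ≤ δ)
    {w w' : LTwo E} {z z' : LTwo F} (h : IsMul σ S w z) (h' : IsMul (σ + δ) S w' z')
    (hw : Integrable w) (hw' : Integrable w')
    (hww : ∀ᵐ t : ℝ, w' t = Complex.exp (-(δ * t : ℝ)) • w t) :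
    ∀ᵐ t : ℝ, z' t = Complex.exp (-(δ * t : ℝ)) • z t := by
  filter_upwards [h.ae_eq_integral_lineKernel hS hσ hw,
    h'.ae_eq_integral_lineKernel hS (by linarith) hw'] with t h1 h2
  rw [h1, h2, ← integral_smul]
  refine integral_congr_ae ?_
  filter_upwards [hww] with τ hτ
  rw [hτ, hS.lineKernel_eq (by linarith : σ₀ < σ + δ) hσ, map_smul, smul_smul, smul_smul,
    ← Complex.exp_add, ← Complex.exp_add]
  congr 2
  push_cast
  ring

/-- Cutting off in time makes an $L^2$ function integrable, as the kernel representation requires.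
-/
theorem exists_truncation {V : Type*} [NormedAddCommGroup V] [NormedSpace ℂ V] (w : LTwo V) :
    ∃ u : ℕ → LTwo V, Tendsto u atTop (𝓝 w) ∧
      ∀ n, ∀ᵐ t, u n t = (Set.Icc (-n : ℝ) n).indicator (fun _ => (1 : ℂ)) t • w t := by
  have hb : ∀ (n : ℕ) (t : ℝ), ‖(Set.Icc (-n : ℝ) n).indicator (fun _ => (1 : ℂ)) t‖ ≤ 1 :=
    fun n t => by simpa using norm_indicator_le_norm_self (fun _ => (1 : ℂ)) t
  choose u hu _ using fun n : ℕ => w.exists_smul (K := 1)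
    (c := (Set.Icc (-n : ℝ) n).indicator (fun _ => (1 : ℂ)))
    (measurable_const.indicator measurableSet_Icc) (Eventually.of_forall fun t => by
      rw [norm_smul]
      gcongr
      exact hb n t)
  refine ⟨u, tendsto_of_ae_eq_smul _ hb (fun t => ?_) hu, hu⟩
  obtain ⟨N, hN⟩ := exists_nat_ge |t|
  refine tendsto_const_nhds.congr' ?_
  filter_upwards [eventually_ge_atTop N] with n hn
  have : |t| ≤ n := hN.trans (by exact_mod_cast hn)
  rw [Set.indicator_of_mem (by exact abs_le.1 this)]

theorem integrable_of_truncation {V : Type*} [NormedAddCommGroup V] [NormedSpace ℂ V]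
    {w u : LTwo V} {n : ℕ}
    (hu : ∀ᵐ t, u t = (Set.Icc (-n : ℝ) n).indicator (fun _ => (1 : ℂ)) t • w t) :
    Integrable u := by
  have h1 : IntegrableOn w (Set.Icc (-n : ℝ) n) :=
    (LTwo.locallyIntegrable w).integrableOn_isCompact isCompact_Icc
  refine (h1.integrable_indicator measurableSet_Icc).congr ?_
  filter_upwards [hu] with t ht
  rw [ht]
  by_cases h : t ∈ Set.Icc (-n : ℝ) n <;> simp [h]

theorem bound_line (hS : IsDecaying σ₀ S) : ∃ K, 0 ≤ K ∧ ∀ s : ℂ, σ₀ < s.re → ‖S s‖ ≤ K := by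
  obtain ⟨C, hC0, hC⟩ := hS.decay
  refine ⟨C, hC0, fun s hs => (hC s hs).trans ?_⟩
  exact mul_le_of_le_one_right hC0 (inv_le_one_of_one_le₀ (by nlinarith [sq_nonneg s.im]))

theorem tendsto_isMul (hS : IsDecaying σ₀ S) (hσ : σ₀ < σ) {w : LTwo E} {z : LTwo F}
    (h : IsMul σ S w z) {u : ℕ → LTwo E} (hu : Tendsto u atTop (𝓝 w)) :
    ∃ y : ℕ → LTwo F, (∀ n, IsMul σ S (u n) (y n)) ∧ Tendsto y atTop (𝓝 z) := by
  obtain ⟨K, _, hK⟩ := hS.bound_line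
  choose d hd hd' using fun n => hS.isSymbol.exists_isMul hσ
    (fun s hs => hK s (by rwa [hs])) (u n - w)
  -- This is $z+d_n$, written with differences because `IsMul.sub` is the form of linearity in use.
  refine ⟨fun n => z - (0 - d n), fun n => ?_, ?_⟩
  · have h0 : IsMul σ S (0 : LTwo E) (0 : LTwo F) := by
      have := h.sub h; rwa [sub_self, sub_self] at this
    have := h.sub (h0.sub (hd n))
    rwa [show w - (0 - (u n - w)) = u n by abel] at this
  · have : Tendsto d atTop (𝓝 0) := by
      refine squeeze_zero_norm hd' ?_
      have := (tendsto_iff_norm_sub_tendsto_zero.1 hu).const_mul K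
      simpa using this
    simpa using (this.const_sub 0).const_sub z

theorem vanishesBefore (hS : IsDecaying σ₀ S) (hσ : σ₀ < σ) {w : LTwo E} {z : LTwo F}
    (h : IsMul σ S w z) {a : ℝ} (ha : VanishesBefore a w) : VanishesBefore a z := by
  obtain ⟨u, hu, hu'⟩ := exists_truncation w
  obtain ⟨y, hy, hy'⟩ := hS.tendsto_isMul hσ h hu
  refine VanishesBefore.of_tendsto hy' fun n => ?_
  refine hS.vanishesBefore_of_integrable hσ (hy n) (integrable_of_truncation (hu' n)) ?_
  filter_upwards [hu' n, ha] with t h1 h2 h3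
  rw [h1, h2 h3, smul_zero]

theorem exp_smul (hS : IsDecaying σ₀ S) (hσ : σ₀ < σ) {δ : ℝ} (hδ : 0 ≤ δ)
    {w w' : LTwo E} {z z' : LTwo F} (h : IsMul σ S w z) (h' : IsMul (σ + δ) S w' z')
    (hww : ∀ᵐ t : ℝ, w' t = Complex.exp (-(δ * t : ℝ)) • w t) :
    ∀ᵐ t : ℝ, z' t = Complex.exp (-(δ * t : ℝ)) • z t := by
  obtain ⟨u, hu, hu1⟩ := exists_truncation w
  obtain ⟨u', hu', hu1'⟩ := exists_truncation w'
  obtain ⟨y, hy, hy1⟩ := hS.tendsto_isMul hσ h hu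
  obtain ⟨y', hy', hy1'⟩ := hS.tendsto_isMul (by linarith) h' hu'
  exact ae_clm_apply_of_tendsto
    (fun _ t => Complex.exp (-(δ * t : ℝ)) • ContinuousLinearMap.id ℂ F)
    (fun t => Complex.exp (-(δ * t : ℝ)) • ContinuousLinearMap.id ℂ F)
    (fun t => tendsto_const_nhds) hy1 hy1' (fun n => by
      have hw : ∀ᵐ t : ℝ, u' n t = Complex.exp (-(δ * t : ℝ)) • u n t := by
        filter_upwards [hu1 n, hu1' n, hww] with t h1 h2 h3
        rw [h1, h2, h3, smul_comm]
      exact hS.exp_smul_of_integrable hσ hδ (hy n) (hy' n) (integrable_of_truncation (hu1 n))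
        (integrable_of_truncation (hu1' n)) hw)

end IsDecaying

/-- Scalar symbols of polynomial decay which tend to `1` as `n → ∞`. -/
def regularizer (σ₀ : ℝ) (N n : ℕ) (s : ℂ) : ℂ :=
  ((1 + ((n : ℝ) + 1)⁻¹ * (s - σ₀)) ^ (N + 2))⁻¹

section Regularizer

variable {N n : ℕ} {s : ℂ}

theorem one_le_norm_one_add (hs : σ₀ < s.re) :
    1 ≤ ‖(1 : ℂ) + ((n : ℝ) + 1)⁻¹ * (s - σ₀)‖ := by
  refine le_trans ?_ (Complex.re_le_norm _)
  have h1 : 0 ≤ ((n : ℝ) + 1)⁻¹ * (s.re - σ₀) := mul_nonneg (by positivity) (by linarith)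
  have h2 : ((1 : ℂ) + ((n : ℝ) + 1)⁻¹ * (s - σ₀)).re = 1 + ((n : ℝ) + 1)⁻¹ * (s.re - σ₀) := by
    rw [show ((1 : ℂ) + ((n : ℝ) + 1)⁻¹ * (s - σ₀))
      = 1 + ((((n : ℝ) + 1)⁻¹ : ℝ) : ℂ) * (s - σ₀) by push_cast; ring]
    rw [Complex.add_re, Complex.re_ofReal_mul]
    simp
  linarith

/-- Solve $q=1+(s-\sigma_0)/(n+1)$ for $s$; since $\operatorname{Re}(q-1)\ge0$, one has
$|q-1|\le|q|$. -/
theorem one_add_norm_le (hs : σ₀ < s.re) :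
    1 + ‖s‖ ≤ (1 + |σ₀| + (n + 1)) * ‖(1 : ℂ) + ((n : ℝ) + 1)⁻¹ * (s - σ₀)‖ := by
  set q := (1 : ℂ) + ((n : ℝ) + 1)⁻¹ * (s - σ₀) with hq
  have h1 : 1 ≤ ‖q‖ := one_le_norm_one_add hs
  have hn : ((n : ℂ) + 1) ≠ 0 := by exact_mod_cast n.succ_ne_zero
  have h2 : s = σ₀ + ((n : ℂ) + 1) * (q - 1) := by
    rw [hq]; push_cast; field_simp; ring_nf
  have h3 : ‖q - 1‖ ≤ ‖q‖ := by
    have hre : 0 ≤ (q - 1).re := by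
      rw [hq, show (1 : ℂ) + ((n : ℝ) + 1)⁻¹ * (s - σ₀) - 1
        = ((((n : ℝ) + 1)⁻¹ : ℝ) : ℂ) * (s - σ₀) by push_cast; ring, Complex.re_ofReal_mul]
      exact mul_nonneg (by positivity) (by simpa using hs.le)
    rw [Complex.norm_def, Complex.norm_def]
    apply Real.sqrt_le_sqrt
    simp only [Complex.normSq_apply, Complex.sub_re, Complex.sub_im, Complex.one_re,
      Complex.one_im] at hre ⊢
    nlinarith
  have h4 : ‖s‖ ≤ |σ₀| + (n + 1) * ‖q - 1‖ := by
    calc ‖s‖ ≤ ‖(σ₀ : ℂ)‖ + ‖((n : ℂ) + 1) * (q - 1)‖ := by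
          conv_lhs => rw [h2]
          exact norm_add_le _ _
      _ = _ := by
          rw [norm_mul, Complex.norm_real, Real.norm_eq_abs]
          congr 2
          exact_mod_cast Complex.norm_natCast (n + 1)
  nlinarith [abs_nonneg σ₀]

theorem norm_regularizer_le_one (hs : σ₀ < s.re) : ‖regularizer σ₀ N n s‖ ≤ 1 := by
  rw [regularizer, norm_inv, norm_pow]
  exact inv_le_one_of_one_le₀ (one_le_pow₀ (one_le_norm_one_add hs))

theorem differentiableOn_regularizer :
    DifferentiableOn ℂ (regularizer σ₀ N n) {s | σ₀ < s.re} := by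
  unfold regularizer
  refine DifferentiableOn.inv (by fun_prop) fun s hs => pow_ne_zero _ fun h => ?_
  have := one_le_norm_one_add (n := n) (show σ₀ < s.re from hs)
  rw [h, norm_zero] at this
  linarith

theorem tendsto_regularizer (N : ℕ) (s : ℂ) :
    Tendsto (fun n => regularizer σ₀ N n s) atTop (𝓝 1) := by
  have h1 : Tendsto (fun n : ℕ => (((n : ℝ) + 1)⁻¹ : ℂ)) atTop (𝓝 0) := by
    have := (tendsto_one_div_add_atTop_nhds_zero_nat (𝕜 := ℝ)).ofReal
    simpa using this
  have h2 := (((h1.mul_const (s - σ₀)).const_add 1).pow (N + 2)).inv₀ (by simp)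
  simpa [regularizer] using h2

/-- Of the $N+2$ powers of the regularizer, $N$ absorb the growth of the symbol and two provide the
quadratic decay. -/
theorem isDecaying_regularizer_smul {C : ℝ} (hC : 0 ≤ C)
    (hd : DifferentiableOn ℂ S {s | σ₀ < s.re})
    (hS : ∀ s : ℂ, σ₀ < s.re → ‖S s‖ ≤ C * (1 + ‖s‖) ^ N) (n : ℕ) :
    IsDecaying σ₀ (fun s => regularizer σ₀ N n s • S s) := by
  refine ⟨differentiableOn_regularizer.smul hd,
    C * (1 + |σ₀| + (n + 1)) ^ (N + 2), by positivity, fun s hs => ?_⟩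
  set K := 1 + |σ₀| + ((n : ℝ) + 1)
  have hb := one_add_norm_le (n := n) hs
  have h1 := one_le_norm_one_add (n := n) hs
  rw [norm_smul, regularizer, norm_inv, norm_pow]
  set q := ‖(1 : ℂ) + ((n : ℝ) + 1)⁻¹ * (s - σ₀)‖
  have h3 : 0 < (1 : ℝ) + s.im ^ 2 := by positivity
  have h4 : 1 + s.im ^ 2 ≤ (1 + ‖s‖) ^ 2 := by
    have := Complex.abs_im_le_norm s
    have h5 : s.im ^ 2 ≤ ‖s‖ ^ 2 := by rw [← sq_abs]; gcongr
    nlinarith [norm_nonneg s]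
  rw [← div_eq_mul_inv, inv_mul_eq_div, div_le_div_iff₀ (by positivity) h3]
  calc ‖S s‖ * (1 + s.im ^ 2) ≤ (C * (1 + ‖s‖) ^ N) * (1 + ‖s‖) ^ 2 := by
        gcongr; exact hS s hs
    _ = C * (1 + ‖s‖) ^ (N + 2) := by ring
    _ ≤ C * (K * q) ^ (N + 2) := by gcongr
    _ = _ := by rw [mul_pow]; ring

end Regularizer

namespace IsSymbol

/-- An unbounded symbol need not map truncations of `w` into $L^2$. Instead the output `z` is damped
by the bounded symbols $c_n$; the result is also the output of $c_nS$, which has a kernel. -/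
theorem exists_regularization (hS : IsSymbol σ₀ S) (hσ : σ₀ < σ) {w : LTwo E} {z : LTwo F}
    (h : IsMul σ S w z) : ∃ (c : ℕ → ℂ → ℂ) (y : ℕ → LTwo F),
      (∀ n, IsDecaying σ₀ fun s => c n s • S s) ∧ (∀ s, Tendsto (fun n => c n s) atTop (𝓝 1)) ∧
      (∀ n, IsMul σ (fun s => c n s • S s) w (y n)) ∧ Tendsto y atTop (𝓝 z) := by
  obtain ⟨C, N, hC, hg⟩ := hS.growth
  have hid : ∀ n, IsSymbol σ₀ fun s => regularizer σ₀ N n s • ContinuousLinearMap.id ℂ F :=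
    fun n => (isSymbol_const σ₀ _).smul differentiableOn_regularizer
      ⟨1, 0, by simp, fun s hs => by simpa using norm_regularizer_le_one hs⟩
  choose y hy _ using fun n => (hid n).exists_isMul hσ (K := 1) (fun s hs => by
    rw [norm_smul]
    exact mul_le_one₀ (norm_regularizer_le_one (by rwa [hs])) (norm_nonneg _)
      ContinuousLinearMap.norm_id_le) z
  refine ⟨regularizer σ₀ N, y, isDecaying_regularizer_smul hC hS.differentiableOn hg,
    tendsto_regularizer N, fun n => ?_, ?_⟩
  · exact (h.comp (hy n)).congr fun s _ => by ext; simp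
  · have : Tendsto (fun n => (𝓕 (y n) : LTwo F)) atTop (𝓝 (𝓕 z)) := by
      refine tendsto_of_ae_eq_smul (fun n ξ => regularizer σ₀ N n (line σ ξ)) (fun n ξ => ?_)
        (fun ξ => tendsto_regularizer N _) fun n => ?_
      · exact norm_regularizer_le_one (by simpa using hσ)
      · exact (hy n).mono fun ξ hξ => by simpa using hξ
    have h2 := ((Lp.fourierTransformₗᵢ ℝ F).symm.continuous.tendsto _).comp this
    have h3 : ∀ u : LTwo F, (Lp.fourierTransformₗᵢ ℝ F).symm (𝓕 u) = u :=
      fun u => (Lp.fourierTransformₗᵢ ℝ F).symm_apply_apply u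
    simpa [Function.comp_def, h3] using h2

/-- Fourier multipliers with holomorphic symbols are causal. -/
theorem vanishesBefore (hS : IsSymbol σ₀ S) (hσ : σ₀ < σ) {w : LTwo E} {z : LTwo F}
    (h : IsMul σ S w z) {a : ℝ} (ha : VanishesBefore a w) : VanishesBefore a z := by
  obtain ⟨c, y, hc, _, hy, hy'⟩ := hS.exists_regularization hσ h
  exact VanishesBefore.of_tendsto hy' fun n => (hc n).vanishesBefore hσ (hy n) ha

/-- Multiplication by `e^{-δt}` moves the line `Re s = σ` of a causal multiplier to
`Re s = σ + δ`. -/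
theorem isMul_exp_smul (hS : IsSymbol σ₀ S) (hσ : σ₀ < σ) {δ : ℝ} (hδ : 0 ≤ δ)
    {w w' : LTwo E} {z z' : LTwo F} (h : IsMul σ S w z) (hw : VanishesBefore 0 w)
    (hww : ∀ᵐ t : ℝ, w' t = Complex.exp (-(δ * t : ℝ)) • w t)
    (hzz : ∀ᵐ t : ℝ, z' t = Complex.exp (-(δ * t : ℝ)) • z t) :
    IsMul (σ + δ) S w' z' := by
  obtain ⟨c, y, hc, hc1, hy, hy'⟩ := hS.exists_regularization hσ h
  have hz := hS.vanishesBefore hσ h hw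
  have hσ' : σ₀ < σ + δ := by linarith
  choose y' h1 _ using fun n => (hc n).isSymbol.exists_isMul hσ'
    (fun s hs => (hc n).bound_line.choose_spec.2 s (by rwa [hs])) w'
  have h2 : ∀ n, ∀ᵐ t : ℝ, y' n t = Complex.exp (-(δ * t : ℝ)) • y n t := fun n =>
    (hc n).exp_smul hσ hδ (hy n) (h1 n) hww
  -- Here $y_n'-z'=e^{-\delta t}(y_n-z)$, and the weight is a contraction because $y_n$ and $z$
  -- vanish for $t<0$.
  have h3 : Tendsto y' atTop (𝓝 z') := by
    rw [tendsto_iff_norm_sub_tendsto_zero] at hy' ⊢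
    refine squeeze_zero (fun _ => norm_nonneg _) (fun n => ?_) hy'
    apply Lp.norm_le_norm_of_ae_le
    filter_upwards [h2 n, hzz, Lp.coeFn_sub (y' n) z', Lp.coeFn_sub (y n) z, hz,
      (hc n).vanishesBefore hσ (hy n) hw] with t g1 g2 g3 g4 g5 g6
    rw [g3, g4, Pi.sub_apply, Pi.sub_apply, g1, g2, ← smul_sub, norm_smul]
    rcases lt_or_ge t 0 with ht | ht
    · simp [g5 ht, g6 ht]
    · refine mul_le_of_le_one_left (norm_nonneg _) ?_
      rw [Complex.norm_exp]
      simpa using mul_nonneg hδ ht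
  have h4 : Tendsto (fun n => (𝓕 (y' n) : LTwo F)) atTop (𝓝 (𝓕 z')) :=
    ((Lp.fourierTransformₗᵢ ℝ F).continuous.tendsto _).comp h3
  refine ae_clm_apply_of_tendsto (w := fun _ => 𝓕 w')
    (fun n ξ => c n (line (σ + δ) ξ) • S (line (σ + δ) ξ)) _ (fun ξ => ?_) tendsto_const_nhds h4 h1
  simpa using (hc1 (line (σ + δ) ξ)).smul_const (S (line (σ + δ) ξ))

end IsSymbol

end Causality

/-! ### The spaces `H^r_0(0,T;E)` and exponentially weighted densities -/

section SobolevDensity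

set_option linter.unusedSectionVars false

open FourierTransform Filter Topology

/-- The principal branch of `(1 + s)^r`. -/
def shiftPow (r : ℝ) (s : ℂ) : ℂ := (1 + s) ^ (r : ℂ)

theorem shiftPow_zero (s : ℂ) : shiftPow 0 s = 1 := by simp [shiftPow]

theorem norm_shiftPow (r : ℝ) (s : ℂ) : ‖shiftPow r s‖ = ‖1 + s‖ ^ r := Complex.norm_cpow_real _ _

/-- The half-plane $\operatorname{Re}s>-1/2$ keeps $1+s$ off the slit of the principal branch and
contains the imaginary axis in its interior, so that $\sigma=0$ is an admissible line. -/
theorem one_add_ne_zero {s : ℂ} (hs : -(1 / 2) < s.re) : 1 + s ≠ 0 := by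
  intro h
  have := congrArg Complex.re h
  simp at this
  linarith

theorem shiftPow_add {r r' : ℝ} {s : ℂ} (hs : -(1 / 2) < s.re) :
    shiftPow (r + r') s = shiftPow r s * shiftPow r' s := by
  rw [shiftPow, Complex.ofReal_add, Complex.cpow_add _ _ (one_add_ne_zero hs)]; rfl

theorem shiftPow_neg_mul {r : ℝ} {s : ℂ} (hs : -(1 / 2) < s.re) :
    shiftPow (-r) s * shiftPow r s = 1 := by
  rw [← shiftPow_add hs, neg_add_cancel, shiftPow_zero]

theorem half_lt_norm_one_add {s : ℂ} (hs : -(1 / 2) < s.re) : 1 / 2 < ‖1 + s‖ := by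
  have := Complex.re_le_norm (1 + s)
  simp at this
  linarith

theorem differentiableOn_shiftPow {r σ₀ : ℝ} (hσ : -(1 / 2) ≤ σ₀) :
    DifferentiableOn ℂ (shiftPow r) {s | σ₀ < s.re} := by
  intro s hs
  have hs : σ₀ < s.re := hs
  refine (DifferentiableAt.cpow_const (by fun_prop) ?_).differentiableWithinAt
  left
  simp
  linarith

theorem shiftPow_growth {r σ₀ : ℝ} (hσ : -(1 / 2) ≤ σ₀) :
    ∃ (C : ℝ) (N : ℕ), 0 ≤ C ∧ ∀ s : ℂ, σ₀ < s.re → ‖shiftPow r s‖ ≤ C * (1 + ‖s‖) ^ N := by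
  rcases le_total 0 r with hr | hr
  · refine ⟨1, ⌈r⌉₊, zero_le_one, fun s hs => ?_⟩
    have h1 : 1 ≤ 1 + ‖s‖ := by linarith [norm_nonneg s]
    rw [norm_shiftPow, one_mul, ← Real.rpow_natCast]
    calc ‖1 + s‖ ^ r ≤ (1 + ‖s‖) ^ r := by
          gcongr; exact (norm_add_le _ _).trans (by simp)
      _ ≤ _ := Real.rpow_le_rpow_of_exponent_le h1 (Nat.le_ceil r)
  · refine ⟨(1 / 2) ^ r, 0, by positivity, fun s hs => ?_⟩
    rw [norm_shiftPow, pow_zero, mul_one]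
    exact Real.rpow_le_rpow_of_nonpos (by norm_num)
      (half_lt_norm_one_add (by linarith)).le hr

theorem norm_shiftPow_neg_le_one {r : ℝ} (hr : 0 ≤ r) {s : ℂ} (hs : 0 ≤ s.re) :
    ‖shiftPow (-r) s‖ ≤ 1 := by
  rw [norm_shiftPow]
  apply Real.rpow_le_one_of_one_le_of_nonpos _ (by linarith)
  have := Complex.re_le_norm (1 + s)
  simp at this
  linarith

/-- Raise $|1+2\pi i\xi|\le2\pi\sqrt{1+\xi^2}$ to the power $r$. The reverse comparison in
`rpow_mul_norm_shiftPow_neg_le` needs no constant. -/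
theorem norm_shiftPow_line_le {r : ℝ} (hr : 0 ≤ r) (ξ : ℝ) :
    ‖shiftPow r (line 0 ξ)‖ ≤ (2 * Real.pi) ^ r * (1 + ξ ^ 2) ^ (r / 2) := by
  have hpi : 1 ≤ 2 * Real.pi := by linarith [Real.pi_gt_three]
  have h1 : ‖1 + line 0 ξ‖ ≤ 2 * Real.pi * Real.sqrt (1 + ξ ^ 2) := by
    rw [Complex.norm_def, Real.sqrt_le_left (by positivity), mul_pow, Real.sq_sqrt (by positivity)]
    simp [Complex.normSq_apply]
    nlinarith [sq_nonneg ξ]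
  rw [norm_shiftPow]
  calc _ ≤ (2 * Real.pi * Real.sqrt (1 + ξ ^ 2)) ^ r := by gcongr
    _ = _ := by
      rw [Real.mul_rpow (by positivity) (by positivity), Real.sqrt_eq_rpow,
        ← Real.rpow_mul (by positivity)]
      congr 2; ring

theorem rpow_mul_norm_shiftPow_neg_le {r : ℝ} (hr : 0 ≤ r) (ξ : ℝ) :
    (1 + ξ ^ 2) ^ (r / 2) * ‖shiftPow (-r) (line 0 ξ)‖ ≤ 1 := by
  have hpi : 1 ≤ 2 * Real.pi := by linarith [Real.pi_gt_three]
  have h1 : Real.sqrt (1 + ξ ^ 2) ≤ ‖1 + line 0 ξ‖ := by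
    rw [Complex.norm_def]
    apply Real.sqrt_le_sqrt
    simp only [Complex.normSq_apply, Complex.add_re, Complex.one_re, line_re, Complex.add_im,
      Complex.one_im, line_im]
    nlinarith [mul_nonneg (sq_nonneg ξ) (sub_nonneg.2 hpi), sq_nonneg ξ]
  have h2 : (1 + ξ ^ 2) ^ (r / 2) = Real.sqrt (1 + ξ ^ 2) ^ r := by
    rw [Real.sqrt_eq_rpow, ← Real.rpow_mul (by positivity)]; congr 1; ring
  have h3 : 0 < Real.sqrt (1 + ξ ^ 2) := Real.sqrt_pos.2 (by positivity)
  rw [norm_shiftPow, h2, Real.rpow_neg (norm_nonneg _), ← div_eq_mul_inv]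
  apply div_le_one_of_le₀ _ (by positivity)
  gcongr

variable {E : Type*} [NormedAddCommGroup E] [InnerProductSpace ℂ E] [CompleteSpace E]

theorem isSymbol_shiftPow (E : Type*) [NormedAddCommGroup E] [InnerProductSpace ℂ E]
    [CompleteSpace E] (r : ℝ) {σ₀ : ℝ} (hσ : -(1 / 2) ≤ σ₀) :
    IsSymbol σ₀ (fun s => shiftPow r s • ContinuousLinearMap.id ℂ E) :=
  (isSymbol_const σ₀ _).smul (differentiableOn_shiftPow hσ) (shiftPow_growth hσ)

/-- After a Fourier transform both sides are locally integrable functions, which are compared by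
testing with Schwartz functions. -/
theorem besselPotential_eq_iff (r : ℝ) (G v : LTwo E) :
    besselPotential ℝ E r (G : 𝓢'(ℝ, E)) = (v : 𝓢'(ℝ, E)) ↔
      ∀ᵐ ξ : ℝ, (𝓕 v : LTwo E) ξ = (((1 + ξ ^ 2) ^ (r / 2) : ℝ) : ℂ) • (𝓕 G : LTwo E) ξ := by
  have hm : Function.HasTemperateGrowth fun x : ℝ => (((1 + ‖x‖ ^ 2) ^ (r / 2) : ℝ) : ℂ) := by
    fun_prop
  have hcont : Continuous fun x : ℝ => (((1 + x ^ 2) ^ (r / 2) : ℝ) : ℂ) := by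
    simpa using hm.1.continuous
  have h0 : besselPotential ℝ E r (G : 𝓢'(ℝ, E)) = (v : 𝓢'(ℝ, E)) ↔
      smulLeftCLM E (fun x : ℝ => (((1 + ‖x‖ ^ 2) ^ (r / 2) : ℝ) : ℂ))
        ((𝓕 G : LTwo E) : 𝓢'(ℝ, E)) = ((𝓕 v : LTwo E) : 𝓢'(ℝ, E)) := by
    rw [← Lp.fourier_toTemperedDistribution_eq, ← Lp.fourier_toTemperedDistribution_eq,
      ← fourier_besselPotential_eq_smulLeftCLM_fourier_apply]
    constructor
    · intro h; rw [h]
    · intro h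
      have := congrArg (fun d : 𝓢'(ℝ, E) => 𝓕⁻ d) h
      simp only [FourierTransform.fourierInv_fourier_eq] at this
      exact this
  have h1 : ∀ φ : 𝓢(ℝ, ℂ), smulLeftCLM E (fun x : ℝ => (((1 + ‖x‖ ^ 2) ^ (r / 2) : ℝ) : ℂ))
        ((𝓕 G : LTwo E) : 𝓢'(ℝ, E)) φ
      = ∫ ξ, φ ξ • (((1 + ξ ^ 2) ^ (r / 2) : ℝ) : ℂ) • (𝓕 G : LTwo E) ξ := by
    intro φ
    rw [smulLeftCLM_apply_apply, Lp.toTemperedDistribution_apply]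
    refine integral_congr_ae (Eventually.of_forall fun ξ => ?_)
    beta_reduce
    rw [SchwartzMap.smulLeftCLM_apply_apply hm, smul_eq_mul, mul_smul, smul_comm, Real.norm_eq_abs,
      sq_abs]
  rw [h0]
  constructor
  · intro h
    refine EventuallyEq.symm (ae_eq_of_forall_integral_schwartz_smul_eq ?_
      (LTwo.locallyIntegrable _) fun φ _ => ?_)
    · have := (LTwo.locallyIntegrable (𝓕 G : LTwo E))
      rw [locallyIntegrable_iff] at this ⊢
      exact fun k hk => (this k hk).continuousOn_smul hcont.continuousOn hk
    · rw [← h1, h, Lp.toTemperedDistribution_apply]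
  · intro h
    ext φ
    rw [h1, Lp.toTemperedDistribution_apply]
    exact integral_congr_ae (h.mono fun ξ hξ => by simp only [hξ])

theorem norm_exp_neg_smul_le {δ : ℝ} (hδ : 0 ≤ δ) {u : LTwo E} (hu : VanishesBefore 0 u) :
    ∀ᵐ t : ℝ, ‖Complex.exp (-(δ * t : ℝ)) • u t‖ ≤ 1 * ‖u t‖ := by
  filter_upwards [hu] with t ht
  rcases lt_or_ge t 0 with h | h
  · simp [ht h]
  · rw [norm_smul, Complex.norm_exp]
    gcongr
    simpa using mul_nonneg hδ h

/-- The Bessel potential `v` need not be causal, but $u=(1+\partial_t)^rG$ is, because its symbol is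
holomorphic; its norm is comparable. Weighting $u$ and $G$ by $e^{-\sigma t}$ moves the relation to
the line $\operatorname{Re}s=\sigma$. -/
theorem IsCausalExtension.exists_density {r T σ : ℝ} (hr : 0 ≤ r) (hσ : 0 < σ) {g : ℝ → E}
    {G v : LTwo E} (h : IsCausalExtension r T g G v) :
    ∃ y x : LTwo E, VanishesBefore 0 y ∧ ‖y‖ ≤ (2 * Real.pi) ^ r * ‖v‖ ∧ VanishesBefore 0 x ∧
      IsMul σ (fun s => shiftPow (-r) s • ContinuousLinearMap.id ℂ E) y x ∧
      ∀ᵐ t : ℝ, 0 < t → t < T → x t = Complex.exp (-(σ * t : ℝ)) • g t := by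
  obtain ⟨hv, hG, hg⟩ := h
  rw [besselPotential_eq_iff] at hv
  have hline : Continuous fun ξ => shiftPow r (line 0 ξ) := by
    refine (differentiableOn_shiftPow (r := r) le_rfl).continuousOn.comp_continuous
      (continuous_line 0) fun ξ => ?_
    change -(1 / 2) < (line 0 ξ).re
    rw [line_re]
    norm_num
  have hb : ∀ᵐ ξ : ℝ, ‖shiftPow r (line 0 ξ) • (𝓕 G : LTwo E) ξ‖
      ≤ (2 * Real.pi) ^ r * ‖(𝓕 v : LTwo E) ξ‖ := by
    filter_upwards [hv] with ξ hξ
    rw [hξ, norm_smul, norm_smul, Complex.norm_real, Real.norm_of_nonneg (by positivity),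
      ← mul_assoc]
    gcongr
    exact norm_shiftPow_line_le hr ξ
  have hm : MemLp (fun ξ => shiftPow r (line 0 ξ) • (𝓕 G : LTwo E) ξ) 2 volume :=
    (Lp.memLp (𝓕 v : LTwo E)).of_le_mul
      (hline.aestronglyMeasurable.smul (Lp.aestronglyMeasurable _)) hb
  set u : LTwo E := 𝓕⁻ (hm.toLp _)
  have hu : (𝓕 u : LTwo E) = hm.toLp _ := fourier_fourierInv_eq _
  have hu' : ∀ᵐ ξ, (𝓕 u : LTwo E) ξ = shiftPow r (line 0 ξ) • (𝓕 G : LTwo E) ξ := by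
    rw [hu]; exact hm.coeFn_toLp
  have hun : ‖u‖ ≤ (2 * Real.pi) ^ r * ‖v‖ := by
    rw [← Lp.norm_fourier_eq, ← Lp.norm_fourier_eq v]
    apply Lp.norm_le_mul_norm_of_ae_le_mul
    filter_upwards [hu', hb] with ξ h1 h2
    rwa [h1]
  have hmul : IsMul 0 (fun s => shiftPow r s • ContinuousLinearMap.id ℂ E) G u := by
    simpa [IsMul] using hu'
  have hmul' : IsMul 0 (fun s => shiftPow (-r) s • ContinuousLinearMap.id ℂ E) u G := by
    filter_upwards [hu'] with ξ hξ
    rw [hξ]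
    simp only [smul_apply, ContinuousLinearMap.id_apply, smul_smul]
    rw [shiftPow_neg_mul (by simp), one_smul]
  have hu0 : VanishesBefore 0 u :=
    (isSymbol_shiftPow E r le_rfl).vanishesBefore (by norm_num) hmul hG
  have hmeas : Measurable fun t : ℝ => Complex.exp (-(σ * t : ℝ)) := by fun_prop
  obtain ⟨y, hy, hyn⟩ := u.exists_smul hmeas (norm_exp_neg_smul_le hσ.le hu0)
  obtain ⟨x, hx, -⟩ := G.exists_smul hmeas (norm_exp_neg_smul_le hσ.le hG)
  refine ⟨y, x, ?_, by linarith, ?_, ?_, ?_⟩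
  · filter_upwards [hy, hu0] with t h1 h2 h3
    rw [h1, h2 h3, smul_zero]
  · filter_upwards [hx, hG] with t h1 h2 h3
    rw [h1, h2 h3, smul_zero]
  · have := (isSymbol_shiftPow E (-r) le_rfl).isMul_exp_smul (by norm_num) hσ.le hmul' hu0 hy hx
    rwa [zero_add] at this
  · filter_upwards [hx, hg] with t h1 h2 h3 h4
    rw [h1, h2 h3 h4]

theorem IsMul.eqOn_of_vanishesBefore {F : Type*} [NormedAddCommGroup F] [InnerProductSpace ℂ F]
    [CompleteSpace F] {σ₀ σ : ℝ} {S : ℂ → E →L[ℂ] F}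
    {w w' : LTwo E} {z z' : LTwo F} (h : IsMul σ S w z) (h' : IsMul σ S w' z')
    (hS : IsSymbol σ₀ S) (hσ : σ₀ < σ) {a : ℝ} (hw : ∀ᵐ t, t < a → w t = w' t) :
    ∀ᵐ t, t < a → z t = z' t := by
  have := hS.vanishesBefore hσ (h.sub h') (a := a) (by
    filter_upwards [hw, Lp.coeFn_sub w w'] with t h1 h2 h3
    rw [h2, Pi.sub_apply, h1 h3, sub_self])
  filter_upwards [this, Lp.coeFn_sub z z'] with t h1 h2 h3
  have := h1 h3
  rwa [h2, Pi.sub_apply, sub_eq_zero] at this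

/-- Converse of `IsCausalExtension.exists_density`: the density is cut off at $T$ before the weight
is removed, so that removing it costs at most $e^{\sigma T}$. By causality the cut does not affect
the values on $(0,T)$. -/
theorem exists_isCausalExtension_of_density {r T σ : ℝ} (hr : 0 ≤ r) (hσ : 0 < σ) {f : ℝ → E}
    {y x : LTwo E} (hy : VanishesBefore 0 y)
    (h : IsMul σ (fun s => shiftPow (-r) s • ContinuousLinearMap.id ℂ E) y x)
    (hf : ∀ᵐ t : ℝ, 0 < t → t < T → x t = Complex.exp (-(σ * t : ℝ)) • f t) :
    ∃ G v : LTwo E, IsCausalExtension r T f G v ∧ ‖v‖ ≤ Real.exp (σ * T) * ‖y‖ := by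
  have hsym := isSymbol_shiftPow E (-r) (le_refl (-(1 / 2) : ℝ))
  have hbd : ∀ {τ : ℝ}, 0 ≤ τ → ∀ s : ℂ, s.re = τ →
      ‖shiftPow (-r) s • ContinuousLinearMap.id ℂ E‖ ≤ 1 := by
    intro τ hτ s hs
    rw [norm_smul]
    exact mul_le_one₀ (norm_shiftPow_neg_le_one hr (by rwa [hs])) (norm_nonneg _)
      ContinuousLinearMap.norm_id_le
  obtain ⟨u, hu, hun⟩ := y.exists_smul (K := Real.exp (σ * T))
    (c := (Set.Iio T).indicator fun t : ℝ => Complex.exp (σ * t : ℝ))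
    (Measurable.indicator (by fun_prop) measurableSet_Iio) (Eventually.of_forall fun t => by
      rw [norm_smul]
      gcongr
      by_cases ht : t < T
      · rw [Set.indicator_of_mem (by exact ht), Complex.norm_exp]
        simp only [Complex.ofReal_re]
        gcongr
      · rw [Set.indicator_of_notMem (by exact ht), norm_zero]
        positivity)
  have hu0 : VanishesBefore 0 u := by
    filter_upwards [hu, hy] with t h1 h2 h3
    rw [h1, h2 h3, smul_zero]
  obtain ⟨G, hG, -⟩ := hsym.exists_isMul (σ := 0) (by norm_num) (hbd le_rfl) u
  have hG0 := hsym.vanishesBefore (by norm_num) hG hu0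
  have hmeas : Measurable fun t : ℝ => Complex.exp (-(σ * t : ℝ)) := by fun_prop
  obtain ⟨y₁, hy₁, -⟩ := u.exists_smul hmeas (norm_exp_neg_smul_le hσ.le hu0)
  obtain ⟨x₁, hx₁, -⟩ := G.exists_smul hmeas (norm_exp_neg_smul_le hσ.le hG0)
  have hmul : IsMul σ (fun s => shiftPow (-r) s • ContinuousLinearMap.id ℂ E) y₁ x₁ := by
    have := hsym.isMul_exp_smul (by norm_num) hσ.le hG hu0 hy₁ hx₁
    rwa [zero_add] at this
  have hxx := hmul.eqOn_of_vanishesBefore h hsym (by linarith) (a := T) (by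
    filter_upwards [hy₁, hu] with t h1 h2 h3
    rw [h1, h2, Set.indicator_of_mem (by exact h3), smul_smul, ← Complex.exp_add]
    simp)
  have hb : ∀ᵐ ξ : ℝ, ‖(((1 + ξ ^ 2) ^ (r / 2) : ℝ) : ℂ) • (𝓕 G : LTwo E) ξ‖
      ≤ 1 * ‖(𝓕 u : LTwo E) ξ‖ := by
    filter_upwards [hG] with ξ hξ
    rw [hξ]
    simp only [smul_apply, ContinuousLinearMap.id_apply]
    rw [norm_smul, norm_smul, Complex.norm_real, Real.norm_of_nonneg (by positivity), ← mul_assoc]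
    gcongr
    exact rpow_mul_norm_shiftPow_neg_le hr ξ
  have hcont : Continuous fun x : ℝ => (((1 + x ^ 2) ^ (r / 2) : ℝ) : ℂ) := by
    refine Complex.continuous_ofReal.comp (Continuous.rpow_const (by fun_prop) fun x => ?_)
    left; positivity
  have hm : MemLp (fun ξ : ℝ => (((1 + ξ ^ 2) ^ (r / 2) : ℝ) : ℂ) • (𝓕 G : LTwo E) ξ) 2 volume :=
    (Lp.memLp (𝓕 u : LTwo E)).of_le_mul
      (hcont.aestronglyMeasurable.smul (Lp.aestronglyMeasurable _)) hb
  have hv : (𝓕 (𝓕⁻ (hm.toLp _) : LTwo E) : LTwo E) = hm.toLp _ := fourier_fourierInv_eq _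
  refine ⟨G, 𝓕⁻ (hm.toLp _), ⟨?_, hG0, ?_⟩, ?_⟩
  · rw [besselPotential_eq_iff, hv]
    exact hm.coeFn_toLp
  · filter_upwards [hf, hxx, hx₁] with t h1 h2 h3 h4 h5
    have := (h3.symm.trans (h2 h5)).trans (h1 h4 h5)
    rwa [(smul_right_injective E (Complex.exp_ne_zero _)).eq_iff] at this
  · have h1 : ‖(𝓕⁻ (hm.toLp _) : LTwo E)‖ ≤ 1 * ‖u‖ := by
      rw [← Lp.norm_fourier_eq, hv, ← Lp.norm_fourier_eq u]
      apply Lp.norm_le_mul_norm_of_ae_le_mul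
      filter_upwards [hm.coeFn_toLp, hb] with ξ h1 h2
      rwa [h1]
    linarith

/-- Used with the Riesz isometry: the multiplier calculus rests on Plancherel and thus needs Hilbert
space values, while the data take values in the anti-dual. -/
theorem IsCausalExtension.comp_linearIsometryEquiv {V : Type*} [NormedAddCommGroup V]
    [NormedSpace ℂ V] [CompleteSpace V] (R : V ≃ₗᵢ[ℂ] E) {r T : ℝ} {g : ℝ → V} {G v : LTwo V}
    (h : IsCausalExtension r T g G v) :
    ∃ G' v' : LTwo E, IsCausalExtension r T (fun t => R (g t)) G' v' ∧ ‖v'‖ = ‖v‖ := by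
  let P : V →L[ℂ] E := R.toContinuousLinearEquiv
  have key : ∀ (u : LTwo V) (ψ : 𝓢(ℝ, ℂ)),
      ((P.compLp u : LTwo E) : 𝓢'(ℝ, E)) ψ = P ((u : 𝓢'(ℝ, V)) ψ) := by
    intro u ψ
    rw [Lp.toTemperedDistribution_apply, Lp.toTemperedDistribution_apply, ← P.integral_comp_comm]
    · refine integral_congr_ae ((P.coeFn_compLp u).mono fun t ht => ?_)
      simp only [ht, map_smul]
    · exact memLp_one_iff_integrable.1 ((Lp.memLp u).smul (ψ.memLp 2 volume))
  obtain ⟨h1, h2, h3⟩ := h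
  refine ⟨P.compLp G, P.compLp v, ⟨?_, ?_, ?_⟩, ?_⟩
  · ext φ
    have := congrArg (fun d => d φ) h1
    simp only [besselPotential, TemperedDistribution.fourierMultiplierCLM_apply,
      TemperedDistribution.fourierInv_apply, smulLeftCLM_apply_apply,
      TemperedDistribution.fourier_apply] at this ⊢
    rw [key, key, this]
  · filter_upwards [h2, P.coeFn_compLp G] with t g1 g2 g3
    rw [g2, g1 g3, map_zero]
  · filter_upwards [h3, P.coeFn_compLp G] with t g1 g2 g3 g4
    rw [g2, g1 g3 g4]
    rfl
  · rw [Lp.norm_def, Lp.norm_def]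
    congr 1
    refine eLpNorm_congr_norm_ae ((P.coeFn_compLp v).mono fun t ht => ?_)
    rw [ht]
    exact R.norm_map _

theorem hZeroNorm_congr {V : Type*} [NormedAddCommGroup V] [NormedSpace ℂ V] [CompleteSpace V]
    {r T : ℝ} {f g : ℝ → V} (h : ∀ᵐ t : ℝ, 0 < t → t < T → f t = g t) :
    hZeroNorm r T f = hZeroNorm r T g := by
  have : ∀ G v, IsCausalExtension r T f G v ↔ IsCausalExtension r T g G v := by
    intro G v
    refine and_congr_right fun _ => and_congr_right fun _ => ⟨fun h' => ?_, fun h' => ?_⟩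
    · filter_upwards [h, h'] with t h1 h2 h3 h4
      rw [h2 h3 h4, h1 h3 h4]
    · filter_upwards [h, h'] with t h1 h2 h3 h4
      rw [h2 h3 h4, h1 h3 h4]
  simp only [hZeroNorm, this]

theorem hZeroNorm_le_of_isCausalExtension {V : Type*} [NormedAddCommGroup V] [NormedSpace ℂ V]
    [CompleteSpace V] {r T : ℝ} {f : ℝ → V} {G v : LTwo V} (h : IsCausalExtension r T f G v) :
    hZeroNorm r T f ≤ ‖v‖ₑ :=
  iInf_le_of_le G (iInf_le_of_le v (iInf_le _ h))

theorem MemHZero.memLp_indicator {V : Type*} [NormedAddCommGroup V] [NormedSpace ℂ V]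
    [CompleteSpace V] {r T : ℝ} {f : ℝ → V} (h : MemHZero r T f) :
    MemLp ((Set.Ioo 0 T).indicator f) 2 (volume : Measure ℝ) := by
  obtain ⟨G, v, -, -, hf⟩ := h
  refine ((Lp.memLp G).indicator (measurableSet_Ioo (a := 0) (b := T))).ae_eq ?_
  filter_upwards [hf] with t ht
  by_cases h : t ∈ Set.Ioo 0 T
  · simp [h, ht h.1 h.2]
  · simp [h]

end SobolevDensity

/-! ### Convolution equations as identities between Fourier multipliers -/

section ConvolutionEquation

set_option linter.unusedSectionVars false

open FourierTransform Filter Topology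

variable {E F : Type*} [NormedAddCommGroup E] [InnerProductSpace ℂ E] [CompleteSpace E]
  [NormedAddCommGroup F] [InnerProductSpace ℂ F] [CompleteSpace F]

/-- `w` is the weighted zero extension `e^{-σt} φ(t)`, `0 < t < T`, of `φ|_{(0,T)}`. -/
def IsWeighted {V : Type*} [NormedAddCommGroup V] [NormedSpace ℂ V] (σ T : ℝ) (φ : ℝ → V)
    (w : LTwo V) : Prop :=
  ∀ᵐ t : ℝ, w t = (Set.Ioo 0 T).indicator (fun t => Complex.exp (-(σ * t : ℝ)) • φ t) t

theorem exists_isWeighted {V : Type*} [NormedAddCommGroup V] [NormedSpace ℂ V] {σ T : ℝ}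
    (hσ : 0 ≤ σ) {φ : ℝ → V} (hφ : MemLp ((Set.Ioo 0 T).indicator φ) 2 (volume : Measure ℝ)) :
    ∃ w : LTwo V, IsWeighted σ T φ w := by
  obtain ⟨w, hw, -⟩ := LTwo.exists_smul (hφ.toLp _ : LTwo V) (K := 1)
    (c := fun t : ℝ => Complex.exp (-(σ * t : ℝ))) (by fun_prop) (by
      filter_upwards [hφ.coeFn_toLp] with t ht
      rw [ht]
      by_cases h : t ∈ Set.Ioo 0 T
      · rw [norm_smul, Complex.norm_exp]
        gcongr
        simpa using mul_nonneg hσ h.1.le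
      · simp [h])
  refine ⟨w, ?_⟩
  filter_upwards [hw, hφ.coeFn_toLp] with t h1 h2
  rw [h1, h2]
  by_cases h : t ∈ Set.Ioo 0 T <;> simp [h]

namespace IsWeighted

variable {V : Type*} [NormedAddCommGroup V] [NormedSpace ℂ V] {σ T : ℝ} {φ : ℝ → V} {w : LTwo V}

theorem eq_smul (h : IsWeighted σ T φ w) :
    ∀ᵐ t : ℝ, 0 < t → t < T → w t = Complex.exp (-(σ * t : ℝ)) • φ t := by
  filter_upwards [h] with t ht h1 h2
  rw [ht, Set.indicator_of_mem (Set.mem_Ioo.2 ⟨h1, h2⟩)]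

theorem eq_zero (h : IsWeighted σ T φ w) : ∀ᵐ t : ℝ, t ∉ Set.Ioo 0 T → w t = 0 := by
  filter_upwards [h] with t ht h1
  rw [ht, Set.indicator_of_notMem h1]

theorem vanishesBefore (h : IsWeighted σ T φ w) : VanishesBefore 0 w := by
  filter_upwards [h.eq_zero] with t ht h1
  exact ht fun h2 => lt_asymm h1 h2.1

theorem integrable (h : IsWeighted σ T φ w) : Integrable w := by
  have h1 : IntegrableOn w (Set.Icc 0 T) :=
    (LTwo.locallyIntegrable w).integrableOn_isCompact isCompact_Icc
  refine (h1.integrable_indicator measurableSet_Icc).congr ?_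
  filter_upwards [h.eq_zero] with t ht
  by_cases h : t ∈ Set.Icc 0 T
  · simp [h]
  · rw [Set.indicator_of_notMem h, ht fun h2 => h ⟨h2.1.le, h2.2.le⟩]

end IsWeighted

/-- The kernel may be computed on $\operatorname{Re}s=1$, hence `σ₀ < 1`. The integral reduces to
$(0,t]$ because `w` vanishes for $\tau\le0$ and the kernel for $\tau>t$; `t < T` is needed because
`w` is cut off at $T$. -/
theorem IsMul.eq_integratedConv {σ₀ σ T : ℝ} {k : ℕ} {S : ℂ → E →L[ℂ] F}
    (hS : IsDecaying σ₀ fun s => (s ^ k)⁻¹ • S s) (hσ : σ₀ < σ) (h1 : σ₀ < 1)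
    {φ : ℝ → E} {w : LTwo E} {z : LTwo F} (hw : IsWeighted σ T φ w)
    (h : IsMul σ (fun s => (s ^ k)⁻¹ • S s) w z) :
    ∀ᵐ t : ℝ, t < T → z t = Complex.exp (-(σ * t : ℝ)) • integratedConv k S φ t := by
  filter_upwards [h.ae_eq_integral_lineKernel hS hσ hw.integrable] with t ht htT
  rw [ht, integratedConv, ← integral_smul, ← integral_indicator measurableSet_Ioc]
  refine integral_congr_ae ?_
  filter_upwards [hw.eq_smul, hw.eq_zero] with τ h2 h3
  by_cases hτ : τ ∈ Set.Ioc 0 t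
  · rw [Set.indicator_of_mem hτ, h2 hτ.1 (hτ.2.trans_lt htT), invLaplace_eq_lineKernel,
      hS.lineKernel_eq hσ h1, map_smul, smul_smul, ← Complex.exp_add]
    congr 2
    push_cast
    ring
  · rw [Set.indicator_of_notMem hτ]
    rcases le_or_gt τ 0 with h4 | h4
    · rw [h3 fun h5 => h4.not_gt h5.1, map_zero, smul_zero]
    · have h5 : t - τ < 0 := by
        by_contra h6
        exact hτ ⟨h4, by linarith⟩
      rw [hS.lineKernel_of_neg hσ h5]
      simp

theorem map_integratedConv {V : Type*} [NormedAddCommGroup V] [NormedSpace ℂ V] [CompleteSpace V]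
    (R : V ≃ₗᵢ[ℂ] F) {σ₀ : ℝ} (h1 : σ₀ < 1) {k : ℕ} {A : ℂ → E →L[ℂ] V}
    (hA : IsDecaying σ₀ fun s => (s ^ k)⁻¹ • A s) (φ : ℝ → E) (t : ℝ) :
    R (integratedConv k A φ t)
      = integratedConv k (fun s => (R.toContinuousLinearEquiv : V →L[ℂ] F) ∘L A s) φ t := by
  set P : V →L[ℂ] F := R.toContinuousLinearEquiv.toContinuousLinearMap
  have hk : ∀ u : ℝ, invLaplace (fun s => (s ^ k)⁻¹ • (P ∘L A s)) u
      = P ∘L invLaplace (fun s => (s ^ k)⁻¹ • A s) u := by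
    intro u
    rw [invLaplace_eq_lineKernel, invLaplace_eq_lineKernel, lineKernel, lineKernel]
    have := (ContinuousLinearMap.compL ℂ E V F P).integral_comp_comm
      (hA.integrable_exp_smul_line h1 u)
    simpa using this
  simp only [integratedConv, hk]
  exact (R.toContinuousLinearEquiv.integral_comp_comm _).symm

theorem differentiableOn_inv_pow {σ₀ : ℝ} (hσ : 0 ≤ σ₀) (k : ℕ) :
    DifferentiableOn ℂ (fun s : ℂ => (s ^ k)⁻¹) {s | σ₀ < s.re} := by
  refine DifferentiableOn.inv (by fun_prop) fun s hs => pow_ne_zero _ fun h => ?_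
  rw [h] at hs
  exact absurd (show σ₀ < (0 : ℂ).re from hs) (by simpa using hσ)

theorem norm_inv_pow_le {σ₀ : ℝ} (hσ : 0 < σ₀) (k : ℕ) {s : ℂ} (hs : σ₀ ≤ s.re) :
    ‖(s ^ k)⁻¹‖ ≤ (σ₀ ^ k)⁻¹ := by
  rw [norm_inv, norm_pow]
  gcongr
  exact hs.trans (Complex.re_le_norm s)

theorem isSymbol_inv_pow (E : Type*) [NormedAddCommGroup E] [InnerProductSpace ℂ E]
    [CompleteSpace E] {σ₀ : ℝ} (hσ : 0 < σ₀) (k : ℕ) :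
    IsSymbol σ₀ (fun s => (s ^ k)⁻¹ • ContinuousLinearMap.id ℂ E) :=
  (isSymbol_const σ₀ _).smul (differentiableOn_inv_pow hσ.le k)
    ⟨(σ₀ ^ k)⁻¹, 0, by positivity, fun s hs => by simpa using norm_inv_pow_le hσ k hs.le⟩

/-- Multiplication by $s=\sigma+2\pi i\xi$ corresponds to $\sigma+\partial_t$, so this is the weak
form of $(\sigma+\partial_t)p=q$. -/
theorem IsMul.integral_smul_eq {σ : ℝ} (hσ : 0 < σ) {q p : LTwo E}
    (h : IsMul σ (fun s => s⁻¹ • ContinuousLinearMap.id ℂ E) q p) (ζ : 𝓢(ℝ, ℂ)) :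
    ∫ t, ζ t • q t = ∫ t, (σ * ζ t - deriv ζ t) • p t := by
  have hne : ∀ ξ, line σ ξ ≠ 0 := fun ξ h0 => by
    have := congrArg Complex.re h0
    simp at this
    exact hσ.ne' this
  set θ : 𝓢(ℝ, ℂ) := (σ : ℂ) • ζ - SchwartzMap.derivCLM ℂ ℂ ζ
  have hθ : ∀ t, θ t = σ * ζ t - deriv ζ t := fun t => by
    simp [θ, SchwartzMap.derivCLM_apply]
  have hF : ∀ ξ, (𝓕⁻ θ) ξ = line σ ξ * (𝓕⁻ ζ) ξ := by
    intro ξ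
    have hd : (𝓕⁻ (SchwartzMap.derivCLM ℂ ℂ ζ)) ξ = -(2 * Real.pi * ξ * Complex.I) * (𝓕⁻ ζ) ξ := by
      have h1 : Integrable (deriv ζ) := (SchwartzMap.derivCLM ℂ ℂ ζ).integrable.congr
        (Eventually.of_forall fun t => SchwartzMap.derivCLM_apply ℂ ζ t)
      rw [SchwartzMap.fourierInv_coe, SchwartzMap.fourierInv_coe, Real.fourierInv_eq_fourier_neg,
        Real.fourierInv_eq_fourier_neg,
        show (SchwartzMap.derivCLM ℂ ℂ ζ : ℝ → ℂ) = deriv ζ from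
          funext fun t => SchwartzMap.derivCLM_apply ℂ ζ t,
        Real.fourier_deriv ζ.integrable ζ.differentiable h1]
      simp only [smul_eq_mul]
      push_cast
      ring
    have h2 : (𝓕⁻ θ) = (σ : ℂ) • 𝓕⁻ ζ - 𝓕⁻ (SchwartzMap.derivCLM ℂ ℂ ζ) := by
      simp only [θ, sub_eq_add_neg, FourierTransform.fourierInv_add,
        FourierTransform.fourierInv_smul]
      congr 1
      rw [← neg_one_smul ℂ, FourierTransform.fourierInv_smul, neg_one_smul]
    rw [h2]
    simp only [sub_apply, smul_apply, hd, line, smul_eq_mul]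
    push_cast
    ring
  have key : ∀ (χ : 𝓢(ℝ, ℂ)) (u : LTwo E),
      ∫ t, χ t • u t = ∫ ξ, (𝓕⁻ χ) ξ • (𝓕 u : LTwo E) ξ := by
    intro χ u
    rw [integral_smul_fourier, FourierTransform.fourier_fourierInv_eq]
  calc ∫ t, ζ t • q t = ∫ ξ, (𝓕⁻ ζ) ξ • (𝓕 q : LTwo E) ξ := key _ _
    _ = ∫ ξ, (𝓕⁻ θ) ξ • (𝓕 p : LTwo E) ξ := by
        refine integral_congr_ae (h.mono fun ξ hξ => ?_)
        simp only [hξ, hF, smul_apply, ContinuousLinearMap.id_apply, smul_smul]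
        congr 1
        field_simp [hne ξ]
    _ = ∫ t, θ t • p t := (key _ _).symm
    _ = _ := by simp only [hθ]

/-- For $\zeta=e^{\sigma t}\eta$ one has $\sigma\zeta-\zeta'=-e^{\sigma t}\eta'$: the weight absorbs
$\sigma$, and each factor $s^{-1}$ moves one derivative onto $\eta$. -/
theorem IsMul.integral_exp_smul_eq {σ : ℝ} (hσ : 0 < σ) (k : ℕ) : ∀ {q p : LTwo E},
    IsMul σ (fun s => (s ^ k)⁻¹ • ContinuousLinearMap.id ℂ E) q p → ∀ {η : ℝ → ℝ},
    ContDiff ℝ ∞ η → HasCompactSupport η →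
    ∫ t, (Real.exp (σ * t) * η t) • q t
      = (-1 : ℝ) ^ k • ∫ t, (Real.exp (σ * t) * iteratedDeriv k η t) • p t := by
  induction k with
  | zero =>
    intro q p h η _ _
    have : q = p := by
      apply ae_eq_of_fourier_ae_eq
      filter_upwards [h] with ξ hξ
      simp [hξ]
    simp [this]
  | succ k ih =>
    intro q p h η hη hc
    obtain ⟨y, hy, -⟩ := (isSymbol_inv_pow E (half_pos hσ) 1).exists_isMul (half_lt_self hσ)
      (K := ((σ / 2) ^ 1)⁻¹) (fun s hs => by
        rw [norm_smul]
        refine (mul_le_of_le_one_right (norm_nonneg _) ContinuousLinearMap.norm_id_le).trans ?_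
        exact norm_inv_pow_le (half_pos hσ) 1 (by rw [hs]; linarith)) q
    have hy1 : IsMul σ (fun s => s⁻¹ • ContinuousLinearMap.id ℂ E) q y :=
      hy.congr fun s _ => by rw [pow_one]
    have hyp : IsMul σ (fun s => (s ^ k)⁻¹ • ContinuousLinearMap.id ℂ E) y p := by
      filter_upwards [hy1, h] with ξ h1 h2
      rw [h2, h1]
      simp [smul_smul, pow_succ, mul_comm]
    have hζc : HasCompactSupport fun t => ((Real.exp (σ * t) * η t : ℝ) : ℂ) :=
      (hc.mul_left (f := fun t => Real.exp (σ * t))).comp_left (g := Complex.ofReal)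
        Complex.ofReal_zero
    have hζ : ContDiff ℝ ∞ fun t => ((Real.exp (σ * t) * η t : ℝ) : ℂ) :=
      Complex.ofRealCLM.contDiff.comp
        (ContDiff.mul (Real.contDiff_exp.comp (contDiff_const.mul contDiff_id)) hη)
    have h1 := hy1.integral_smul_eq hσ (hζc.toSchwartzMap hζ)
    have hd : ∀ t, deriv (fun t => ((Real.exp (σ * t) * η t : ℝ) : ℂ)) t
        = ((σ * (Real.exp (σ * t) * η t) + Real.exp (σ * t) * deriv η t : ℝ) : ℂ) := by
      intro t
      have e1 : HasDerivAt (fun t => Real.exp (σ * t)) (Real.exp (σ * t) * (σ * 1)) t :=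
        ((hasDerivAt_id t).const_mul σ).exp
      have e2 := (e1.mul (hη.differentiable (by norm_num) t).hasDerivAt).ofReal_comp
      rw [show (fun t => ((Real.exp (σ * t) * η t : ℝ) : ℂ))
        = fun t => ((((fun t => Real.exp (σ * t)) * η) t : ℝ) : ℂ) from rfl, e2.deriv]
      congr 1
      ring
    have hη' : ContDiff ℝ ∞ (deriv η) := (contDiff_infty_iff_deriv.1 hη).2
    have h2 := ih hyp hη' hc.deriv
    rw [iteratedDeriv_succ', pow_succ, mul_neg_one, neg_smul, ← h2, ← integral_neg]
    have e3 : ∀ t, hζc.toSchwartzMap hζ t = ((Real.exp (σ * t) * η t : ℝ) : ℂ) := fun t => rfl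
    have e4 : (hζc.toSchwartzMap hζ : ℝ → ℂ) = fun t => ((Real.exp (σ * t) * η t : ℝ) : ℂ) := rfl
    calc ∫ t, (Real.exp (σ * t) * η t) • q t = ∫ t, hζc.toSchwartzMap hζ t • q t := by
          simp only [e3, Complex.coe_smul]
      _ = _ := h1
      _ = _ := by
          refine integral_congr_ae (Eventually.of_forall fun t => ?_)
          simp only
          rw [e4, hd, ← Complex.ofReal_mul, ← Complex.ofReal_sub, Complex.coe_smul, ← neg_smul]
          congr 1
          ring

theorem exists_iteratedDeriv_eq {b : ℝ} (k : ℕ) : ∀ {g : ℝ → ℝ}, ContDiff ℝ ∞ g →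
    (∀ t, b ≤ t → g t = 0) →
    ∃ G : ℝ → ℝ, ContDiff ℝ ∞ G ∧ (∀ t, b ≤ t → G t = 0) ∧ iteratedDeriv k G = g := by
  induction k with
  | zero => exact fun {g} hg h => ⟨g, hg, h, iteratedDeriv_zero⟩
  | succ k ih =>
    intro g hg h
    obtain ⟨G, hG, hG0, hGd⟩ := ih hg h
    have hd : ∀ t, HasDerivAt (fun t => ∫ x in b..t, G x) (G t) t := fun t =>
      intervalIntegral.integral_hasDerivAt_right (hG.continuous.intervalIntegrable _ _)
        hG.continuous.stronglyMeasurable.stronglyMeasurableAtFilter hG.continuous.continuousAt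
    have hd' : deriv (fun t => ∫ x in b..t, G x) = G := funext fun t => (hd t).deriv
    refine ⟨fun t => ∫ x in b..t, G x, ?_, fun t ht => ?_, ?_⟩
    · exact contDiff_infty_iff_deriv.2 ⟨fun t => (hd t).differentiableAt, by rwa [hd']⟩
    · refine intervalIntegral.integral_zero_ae (Eventually.of_forall fun x hx => ?_)
      rw [Set.uIoc_of_le ht] at hx
      exact hG0 x hx.1.le
    · rw [iteratedDeriv_succ', hd', hGd]

/-- An iterated antiderivative vanishing near $T$ need not vanish far to the left, so it is cut off
between $-2$ and $-1$. The identity is then lost only where the causal functions to be tested are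
zero. -/
theorem exists_isTestFunction_iteratedDeriv_eq {T : ℝ} (k : ℕ) {g : ℝ → ℝ} (hg : ContDiff ℝ ∞ g)
    (hgc : HasCompactSupport g) (hgT : tsupport g ⊆ Set.Iio T) :
    ∃ η, IsTestFunction T η ∧ ∀ t, -1 < t → iteratedDeriv k η t = g t := by
  obtain ⟨b, hbT, hb⟩ : ∃ b < T, ∀ t, b ≤ t → g t = 0 := by
    rcases (tsupport g).eq_empty_or_nonempty with h | h
    · refine ⟨T - 1, by linarith, fun t _ => ?_⟩
      exact image_eq_zero_of_notMem_tsupport (by simp [h])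
    · obtain ⟨c, hc, hc'⟩ := hgc.exists_isGreatest h
      refine ⟨(c + T) / 2, by linarith [show c < T from hgT hc], fun t ht => ?_⟩
      refine image_eq_zero_of_notMem_tsupport fun h2 => ?_
      linarith [show t ≤ c from hc' h2, show c < T from hgT hc]
  obtain ⟨G, hG, hG0, hGd⟩ := exists_iteratedDeriv_eq k hg hb
  have hs : Function.support (fun t => Real.smoothTransition (t + 2) * G t)
      ⊆ Set.Icc (-2) b := by
    intro t ht
    constructor
    · by_contra h
      exact ht (by simp [Real.smoothTransition.zero_of_nonpos (show t + 2 ≤ 0 by linarith)])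
    · by_contra h
      exact ht (by simp [hG0 t (le_of_not_ge h)])
  refine ⟨fun t => Real.smoothTransition (t + 2) * G t, ⟨?_, ?_, ?_⟩, fun t ht => ?_⟩
  · exact (Real.smoothTransition.contDiff.comp (contDiff_id.add contDiff_const)).mul hG
  · exact HasCompactSupport.of_support_subset_isCompact isCompact_Icc hs
  · exact (closure_minimal hs isClosed_Icc).trans fun t ht => lt_of_le_of_lt ht.2 hbT
  · have : (fun t => Real.smoothTransition (t + 2) * G t) =ᶠ[𝓝 t] G := by
      filter_upwards [lt_mem_nhds ht] with x hx
      rw [Real.smoothTransition.one_of_one_le (by linarith), one_mul]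
    rw [this.iteratedDeriv_eq, hGd]

/-- A vanishing $k$-th derivative alone would leave polynomials of degree below $k$; vanishing for
$t<0$ excludes them. -/
theorem vanishesBefore_of_forall_integral_eq_zero {σ T : ℝ} (k : ℕ) {z : LTwo F}
    (hz : VanishesBefore 0 z) (h : ∀ η, IsTestFunction T η →
      ∫ t, (Real.exp (σ * t) * iteratedDeriv k η t) • z t = 0) : VanishesBefore T z := by
  have hloc : LocallyIntegrable (fun t => Real.exp (σ * t) • z t) := by
    have := LTwo.locallyIntegrable z
    rw [locallyIntegrable_iff] at this ⊢
    exact fun k hk => (this k hk).continuousOn_smul (by fun_prop) hk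
  have := isOpen_Iio.ae_eq_zero_of_integral_contDiff_smul_eq_zero (U := Set.Iio T)
    (hloc.locallyIntegrableOn _) fun g hg hgc hgT => by
      obtain ⟨η, hη, hηg⟩ := exists_isTestFunction_iteratedDeriv_eq k hg hgc hgT
      rw [← h η hη]
      refine integral_congr_ae (hz.mono fun t ht => ?_)
      rcases lt_or_ge t 0 with h0 | h0
      · simp [ht h0]
      · simp only [hηg t (by linarith), smul_smul]
        rw [mul_comm]
  filter_upwards [this] with t ht htT
  exact (smul_eq_zero.1 (ht htT)).resolve_left (Real.exp_pos _).ne'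

theorem iteratedDeriv_eq_zero_of_notMem_tsupport {η : ℝ → ℝ} (k : ℕ) {t : ℝ}
    (ht : t ∉ tsupport η) : iteratedDeriv k η t = 0 := by
  have : η =ᶠ[𝓝 t] fun _ => 0 := by
    filter_upwards [(isClosed_tsupport η).isOpen_compl.mem_nhds ht] with x hx
    exact image_eq_zero_of_notMem_tsupport hx
  rw [this.iteratedDeriv_eq]
  simp

theorem iteratedDeriv_eq_zero_of_le {T : ℝ} {η : ℝ → ℝ} (hη : IsTestFunction T η) (k : ℕ) {t : ℝ}
    (ht : T ≤ t) : iteratedDeriv k η t = 0 :=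
  iteratedDeriv_eq_zero_of_notMem_tsupport k fun h => (hη.2.2 h).not_ge ht

/-- The residual of the convolution equation, tested with `η`, in terms of the residual of the
integrated equation. -/
theorem residual_eq_integral {V : Type*} [NormedAddCommGroup V] [NormedSpace ℂ V]
    [CompleteSpace V] (R : V ≃ₗᵢ[ℂ] F) {σ₀ σ T : ℝ} (hσ₀ : 0 < σ₀) (hσ : σ₀ < σ) (h1 : σ₀ < 1)
    {A : ℂ → E →L[ℂ] V} (hA : IsDecaying σ₀ fun s => (s ^ 4)⁻¹ • A s)
    {φ : ℝ → E} {g : ℝ → V} {w : LTwo E} {q p z : LTwo F} (hw : IsWeighted σ T φ w)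
    (hq : IsWeighted σ T (fun t => R (g t)) q)
    (hz : IsMul σ (fun s => (s ^ 4)⁻¹ • ((R.toContinuousLinearEquiv : V →L[ℂ] F) ∘L A s)) w z)
    (hp : IsMul σ (fun s => (s ^ 4)⁻¹ • ContinuousLinearMap.id ℂ F) q p)
    {η : ℝ → ℝ} (hη : IsTestFunction T η) :
    R (convDistribution 4 A φ η - ∫ t in Set.Ioi 0, η t • g t)
      = ∫ t, (Real.exp (σ * t) * iteratedDeriv 4 η t) • (z - p) t := by
  set P : V →L[ℂ] F := R.toContinuousLinearEquiv.toContinuousLinearMap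
  have hPA : IsDecaying σ₀ fun s => (s ^ 4)⁻¹ • (P ∘L A s) := by
    obtain ⟨C, hC, hb⟩ := hA.decay
    refine ⟨?_, ‖P‖ * C, by positivity, fun s hs => ?_⟩
    · have := (differentiableOn_const P).clm_comp hA.differentiableOn
      simpa using this
    · rw [← ContinuousLinearMap.comp_smul, mul_assoc]
      exact (ContinuousLinearMap.opNorm_comp_le _ _).trans (by gcongr; exact hb s hs)
  have hzc := hz.eq_integratedConv hPA hσ h1 hw
  have hexp : ∀ t : ℝ, Complex.exp (-(σ * t : ℝ)) = ((Real.exp (-(σ * t)) : ℝ) : ℂ) := by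
    intro t; push_cast; rfl
  have hcancel : ∀ (t : ℝ) (x : F),
      Real.exp (σ * t) • Complex.exp (-(σ * t : ℝ)) • x = x := by
    intro t x
    rw [hexp, Complex.coe_smul, smul_smul, ← Real.exp_add]
    simp
  -- Only times before $T$ matter, since the derivatives of $\eta$ vanish from $T$ on.
  have e1 : R (convDistribution 4 A φ η)
      = ∫ t, (Real.exp (σ * t) * iteratedDeriv 4 η t) • z t := by
    rw [convDistribution, show ((-1 : ℝ) ^ 4) = 1 by norm_num, one_smul]
    refine (R.toContinuousLinearEquiv.integral_comp_comm _).symm.trans ?_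
    refine integral_congr_ae (hzc.mono fun t ht => ?_)
    rcases lt_or_ge t T with htT | htT
    · simp only [ht htT]
      rw [mul_comm, ← smul_smul, hcancel, ← map_integratedConv R h1 hA]
      exact R.toContinuousLinearEquiv.toContinuousLinearMap.map_smul_of_tower _ _
    · simp [iteratedDeriv_eq_zero_of_le hη 4 htT]
  have e2 : R (∫ t in Set.Ioi 0, η t • g t)
      = ∫ t, (Real.exp (σ * t) * iteratedDeriv 4 η t) • p t := by
    have := hp.integral_exp_smul_eq (hσ₀.trans hσ) 4 hη.1 hη.2.1
    rw [show ((-1 : ℝ) ^ 4) = 1 by norm_num, one_smul] at this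
    rw [← this, ← integral_indicator measurableSet_Ioi]
    refine (R.toContinuousLinearEquiv.integral_comp_comm _).symm.trans ?_
    refine integral_congr_ae ?_
    filter_upwards [hq.eq_smul, hq.eq_zero] with t h2 h3
    by_cases h0 : 0 < t
    · rw [Set.indicator_of_mem (by exact h0)]
      rcases lt_or_ge t T with htT | htT
      · rw [h2 h0 htT, mul_comm, ← smul_smul, hcancel]
        exact R.toContinuousLinearEquiv.toContinuousLinearMap.map_smul_of_tower _ _
      · have := iteratedDeriv_eq_zero_of_le hη 0 htT
        rw [iteratedDeriv_zero] at this
        simp [this]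
    · rw [Set.indicator_of_notMem (by exact h0), h3 fun h => h0 h.1]
      simp
  have hint : ∀ u : LTwo F,
      Integrable fun t => (Real.exp (σ * t) * iteratedDeriv 4 η t) • u t := by
    intro u
    have hc : Continuous fun t => Real.exp (σ * t) * iteratedDeriv 4 η t :=
      (by fun_prop : Continuous fun t => Real.exp (σ * t)).mul
        (hη.1.continuous_iteratedDeriv 4 (by norm_cast))
    have hcs : HasCompactSupport fun t => Real.exp (σ * t) * iteratedDeriv 4 η t := by
      refine HasCompactSupport.mul_left ?_
      refine HasCompactSupport.of_support_subset_isCompact hη.2.1 ?_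
      intro t ht
      by_contra h
      exact ht (iteratedDeriv_eq_zero_of_notMem_tsupport 4 h)
    exact (LTwo.locallyIntegrable u).integrable_smul_left_of_hasCompactSupport hc hcs
  rw [map_sub, e1, e2, ← integral_sub (hint z) (hint p)]
  refine integral_congr_ae ((Lp.coeFn_sub z p).mono fun t ht => ?_)
  simp only [ht, Pi.sub_apply, smul_sub]

end ConvolutionEquation

/-! ### Galerkin semi-discretization -/

section GalerkinSystem

set_option linter.unusedSectionVars false

open FourierTransform Filter Topology

variable {X : Type*} [NormedAddCommGroup X] [InnerProductSpace ℂ X] [CompleteSpace X]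

variable (X) in
/-- The Riesz isomorphism of the anti-dual space with `X`. -/
def antidualEquiv : (X →L⋆[ℂ] ℂ) ≃ₗᵢ[ℂ] X :=
  LinearIsometryEquiv.symm <| LinearIsometryEquiv.ofSurjective
    ⟨(innerSLFlip ℂ : X →L[ℂ] X →L⋆[ℂ] ℂ).toLinearMap, fun x => by
      change ‖innerSLFlip ℂ x‖ = ‖x‖
      refine le_antisymm (ContinuousLinearMap.opNorm_le_bound _ (norm_nonneg _) fun y => ?_) ?_
      · rw [innerSLFlip_apply_apply, mul_comm]
        exact norm_inner_le_norm _ _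
      · rcases eq_or_ne x 0 with rfl | hx
        · simp
        · have h := (innerSLFlip ℂ x).le_opNorm x
          rw [innerSLFlip_apply_apply, inner_self_eq_norm_sq_to_K] at h
          have hx' := norm_pos_iff.2 hx
          rw [norm_pow, RCLike.norm_ofReal, abs_norm, sq] at h
          exact le_of_mul_le_mul_right h hx'⟩
    -- The complex conjugate of an anti-linear functional is linear, and its Riesz vector represents
    -- `f`.
    fun f => by
      obtain ⟨x, hx⟩ := (InnerProductSpace.toDual ℂ X).surjective
        ((starL ℂ : ℂ ≃L⋆[ℂ] ℂ).toContinuousLinearMap.comp f)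
      refine ⟨x, ?_⟩
      ext y
      have := congrArg (fun l => l y) hx
      simp only [InnerProductSpace.toDual_apply_apply] at this
      change inner ℂ y x = f y
      rw [← inner_conj_symm, this]
      simp

theorem inner_antidualEquiv (χ : X) (f : X →L⋆[ℂ] ℂ) : inner ℂ χ (antidualEquiv X f) = f χ := by
  conv_rhs => rw [← (antidualEquiv X).symm_apply_apply f]
  rfl

/-- The symbol of `A(∂ₜ)`, with the anti-dual of `X` identified with `X`. -/
def rieszSymbol (A : ℂ → X →L[ℂ] X →L⋆[ℂ] ℂ) (s : ℂ) : X →L[ℂ] X :=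
  ((antidualEquiv X).toContinuousLinearEquiv : (X →L⋆[ℂ] ℂ) →L[ℂ] X) ∘L A s

theorem inner_rieszSymbol (A : ℂ → X →L[ℂ] X →L⋆[ℂ] ℂ) (s : ℂ) (x y : X) :
    inner ℂ y (rieszSymbol A s x) = A s x y := inner_antidualEquiv y (A s x)

theorem norm_antidualEquiv_comp_le (L : X →L[ℂ] X →L⋆[ℂ] ℂ) :
    ‖((antidualEquiv X).toContinuousLinearEquiv : (X →L⋆[ℂ] ℂ) →L[ℂ] X) ∘L L‖ ≤ ‖L‖ := by
  refine ContinuousLinearMap.opNorm_le_bound _ (ContinuousLinearMap.opNorm_nonneg L) fun x => ?_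
  change ‖antidualEquiv X (L x)‖ ≤ _
  rw [LinearIsometryEquiv.norm_map]
  exact L.le_opNorm x

theorem exists_differentiableOn_inverse {R : Type*} [NormedRing R] [NormedAlgebra ℂ R]
    [CompleteSpace R] {f : ℂ → R} {U : Set ℂ} (hf : DifferentiableOn ℂ f U)
    (hu : ∀ s ∈ U, IsUnit (f s)) :
    ∃ I : ℂ → R, DifferentiableOn ℂ I U ∧ (∀ s ∈ U, I s * f s = 1) ∧ ∀ s ∈ U, f s * I s = 1 :=
  ⟨fun s => Ring.inverse (f s), hf.inverse hu, fun s hs => Ring.inverse_mul_cancel _ (hu s hs),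
    fun s hs => Ring.mul_inverse_cancel _ (hu s hs)⟩

/-- Lax–Milgram in finite dimension: coercivity and Cauchy–Schwarz bound the compression `Dh s` from
below by $\alpha_\sigma|s|^{-2}$, hence it is injective and so bijective. With its inverse `I s`,
the operator is $\iota I(s)\pi$. -/
theorem exists_galerkinInverse (Xh : Submodule ℂ X) [FiniteDimensional ℂ Xh] {D : ℂ → X →L[ℂ] X}
    {α : ℝ → ℝ} (hD : DifferentiableOn ℂ D {s : ℂ | 0 < s.re}) (hα : ∀ σ : ℝ, 0 < σ → 0 < α σ)
    (hc : ∀ σ : ℝ, 0 < σ → ∀ s : ℂ, σ ≤ s.re → ∀ x : X,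
      α σ * ‖s⁻¹ • x‖ ^ 2 ≤ (inner ℂ x (D s x)).re) :
    ∃ B : ℂ → X →L[ℂ] X, DifferentiableOn ℂ B {s : ℂ | 0 < s.re} ∧
      (∀ σ : ℝ, 0 < σ → ∀ s : ℂ, σ ≤ s.re → ‖B s‖ ≤ ‖s‖ ^ 2 / α σ) ∧
      ∀ s : ℂ, 0 < s.re → Xh.starProjection ∘L B s = B s ∧ B s ∘L Xh.starProjection = B s ∧
        Xh.starProjection ∘L D s ∘L B s = Xh.starProjection ∧
        B s ∘L D s ∘L Xh.starProjection = Xh.starProjection := by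
  have : CompleteSpace Xh := FiniteDimensional.complete ℂ Xh
  let π : X →L[ℂ] Xh := Xh.orthogonalProjectionOnto
  let ι : Xh →L[ℂ] X := Xh.subtypeL
  have hP : Xh.starProjection = ι ∘L π := rfl
  have hπι : π ∘L ι = ContinuousLinearMap.id ℂ Xh := by
    ext x
    simp [π, ι]
  let Dh : ℂ → Xh →L[ℂ] Xh := fun s => π ∘L D s ∘L ι
  have hne : ∀ {s : ℂ}, 0 < s.re → s ≠ 0 := fun {s} hs h => by simp [h] at hs
  have hlow : ∀ σ : ℝ, 0 < σ → ∀ s : ℂ, σ ≤ s.re → ∀ x : Xh,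
      ‖x‖ ≤ ‖s‖ ^ 2 / α σ * ‖Dh s x‖ := by
    intro σ hσ s hs x
    have hs0 := norm_pos_iff.2 (hne (hσ.trans_le hs))
    have h1 := hc σ hσ s hs (x : X)
    have h2 : inner ℂ (x : X) (D s x) = inner ℂ x (Dh s x) := by
      rw [Submodule.coe_inner]
      change _ = inner ℂ (x : X) (Xh.starProjection (D s x))
      rw [← Submodule.inner_starProjection_left_eq_right,
        Submodule.starProjection_eq_self_iff.2 x.2]
    rw [h2, norm_smul, norm_inv, mul_pow] at h1
    have h3 : α σ * ((‖s‖⁻¹) ^ 2 * ‖x‖ ^ 2) ≤ ‖x‖ * ‖Dh s x‖ :=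
      h1.trans ((Complex.re_le_norm _).trans (norm_inner_le_norm _ _))
    rcases (norm_nonneg x).eq_or_lt with h0 | h0
    · rw [← h0]
      have := hα σ hσ
      positivity
    · rw [div_mul_eq_mul_div, le_div_iff₀ (hα σ hσ)]
      have h4 : α σ * (‖s‖⁻¹ ^ 2 * ‖x‖) ≤ ‖Dh s x‖ := by
        refine le_of_mul_le_mul_left ?_ h0
        calc _ = α σ * ((‖s‖⁻¹) ^ 2 * ‖x‖ ^ 2) := by ring
          _ ≤ _ := h3
      calc ‖x‖ * α σ = ‖s‖ ^ 2 * (α σ * (‖s‖⁻¹ ^ 2 * ‖x‖)) := by field_simp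
        _ ≤ _ := by gcongr
  have hunit : ∀ s : ℂ, 0 < s.re → IsUnit (Dh s) := by
    intro s hs
    rw [ContinuousLinearMap.isUnit_iff_bijective]
    have hinj : Function.Injective (Dh s) := by
      rw [injective_iff_map_eq_zero]
      intro x hx
      have := hlow s.re hs s le_rfl x
      rw [hx, norm_zero, mul_zero] at this
      exact norm_le_zero_iff.1 this
    exact ⟨hinj, (LinearMap.injective_iff_surjective (f := (Dh s).toLinearMap)).1 hinj⟩
  have hDh : DifferentiableOn ℂ Dh {s : ℂ | 0 < s.re} :=
    (differentiableOn_const π).clm_comp (hD.clm_comp (differentiableOn_const ι))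
  obtain ⟨I, hI, hl, hr⟩ := exists_differentiableOn_inverse (R := Xh →L[ℂ] Xh)
    (f := Dh) (U := {s : ℂ | 0 < s.re}) hDh fun s hs => hunit s hs
  have hl : ∀ s : ℂ, 0 < s.re → I s ∘L Dh s = ContinuousLinearMap.id ℂ Xh := fun s hs => hl s hs
  have hr : ∀ s : ℂ, 0 < s.re → Dh s ∘L I s = ContinuousLinearMap.id ℂ Xh := fun s hs => hr s hs
  refine ⟨fun s => ι ∘L I s ∘L π, ?_, fun σ hσ s hs => ?_, fun s hs => ⟨?_, ?_, ?_, ?_⟩⟩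
  · exact (differentiableOn_const ι).clm_comp (hI.clm_comp (differentiableOn_const π))
  · have hα' := hα σ hσ
    refine ContinuousLinearMap.opNorm_le_bound _ (by positivity) fun x => ?_
    change ‖I s (π x)‖ ≤ _
    refine (hlow σ hσ s hs _).trans ?_
    have := congrArg (fun l => l (π x)) (hr s (hσ.trans_le hs))
    change Dh s (I s (π x)) = π x at this
    rw [this]
    gcongr
    exact Xh.norm_orthogonalProjectionOnto_apply_le x
  · rw [hP, ContinuousLinearMap.comp_assoc, ← ContinuousLinearMap.comp_assoc π, hπι,
      ContinuousLinearMap.id_comp]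
  · rw [hP, ContinuousLinearMap.comp_assoc, ContinuousLinearMap.comp_assoc,
      ← ContinuousLinearMap.comp_assoc π, hπι, ContinuousLinearMap.id_comp]
  · calc _ = ι ∘L (Dh s ∘L I s) ∘L π := rfl
      _ = _ := by rw [hr s hs, ContinuousLinearMap.id_comp, hP]
  · calc _ = ι ∘L (I s ∘L Dh s) ∘L π := rfl
      _ = _ := by rw [hl s hs, ContinuousLinearMap.id_comp, hP]

/-- A symbol `D`, a projection `P` and the inverse `B` of the compression of `D` to the range
of `P`. -/
structure IsGalerkinSystem (σ₀ : ℝ) (D B : ℂ → X →L[ℂ] X) (P : X →L[ℂ] X) : Prop where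
  isSymbol_left : IsSymbol σ₀ D
  isSymbol_inverse : IsSymbol σ₀ B
  isDecaying : IsDecaying σ₀ fun s => (s ^ 4)⁻¹ • D s
  proj_inverse : ∀ s : ℂ, σ₀ < s.re → P ∘L B s = B s
  inverse_proj : ∀ s : ℂ, σ₀ < s.re → B s ∘L P = B s
  proj_comp_inverse : ∀ s : ℂ, σ₀ < s.re → P ∘L D s ∘L B s = P
  inverse_comp_proj : ∀ s : ℂ, σ₀ < s.re → B s ∘L D s ∘L P = P

namespace IsGalerkinSystem

variable {σ₀ σ T : ℝ} {D B : ℂ → X →L[ℂ] X} {P : X →L[ℂ] X}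

theorem exists_isMul (h : IsGalerkinSystem σ₀ D B P) (hσ : σ₀ < σ) (w : LTwo X) :
    ∃ z : LTwo X, IsMul σ (fun s => (s ^ 4)⁻¹ • D s) w z := by
  obtain ⟨K, -, hK⟩ := h.isDecaying.bound_line
  obtain ⟨z, hz, -⟩ := h.isDecaying.isSymbol.exists_isMul hσ (fun s hs => hK s (by rwa [hs])) w
  exact ⟨z, hz⟩

/-- The homogeneous Galerkin equation has only the trivial solution. -/
theorem vanishesBefore (h : IsGalerkinSystem σ₀ D B P) (hσ₀ : 0 < σ₀) (hσ : σ₀ < σ)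
    {d z : LTwo X} (hd : ∀ᵐ t, t < T → P (d t) = d t)
    (hz : IsMul σ (fun s => (s ^ 4)⁻¹ • D s) d z) (hz0 : ∀ᵐ t, t < T → P (z t) = 0) :
    VanishesBefore T d := by
  -- Replacing `d` by `P d` changes nothing before $T$ and makes the values lie in the range of `P`
  -- at all times, so that $BDP=P$ applies in frequency.
  obtain ⟨z', hz'⟩ := h.exists_isMul hσ (P.compLp d)
  have hd' : IsMul σ (fun _ => P) d (P.compLp d) := isMul_const (P.coeFn_compLp d)
  have hy : IsMul σ (fun _ => P) z' (P.compLp z') := isMul_const (P.coeFn_compLp z')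
  have hzz := hz'.eqOn_of_vanishesBefore hz h.isDecaying.isSymbol hσ (a := T) (by
    filter_upwards [hd, P.coeFn_compLp d] with t h1 h2 h3
    rw [h2, h1 h3])
  have hsym : IsSymbol σ₀ fun s => s ^ 4 • B s :=
    h.isSymbol_inverse.smul (by fun_prop) ⟨1, 4, zero_le_one, fun s _ => by
      rw [norm_pow, one_mul]
      gcongr
      linarith⟩
  have hback : IsMul σ (fun s => s ^ 4 • B s) (P.compLp z') (P.compLp d) := by
    filter_upwards [hd', hy, hz'] with ξ h1 h2 h3
    have hs : σ₀ < (line σ ξ).re := by rwa [line_re]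
    have hne : line σ ξ ≠ 0 := fun h0 => by
      rw [h0, Complex.zero_re] at hs; linarith
    rw [h2, h3, h1]
    have h4 := congrArg (fun l => l ((𝓕 d : LTwo X) ξ)) (h.inverse_comp_proj _ hs)
    have h5 := congrArg (fun l => l (D (line σ ξ) (P ((𝓕 d : LTwo X) ξ)))) (h.inverse_proj _ hs)
    simp only [ContinuousLinearMap.comp_apply] at h4 h5
    simp only [smul_apply, map_smul, smul_smul, h5, h4]
    rw [inv_mul_cancel₀ (pow_ne_zero _ hne), one_smul]
  have := hsym.vanishesBefore hσ hback (a := T) (by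
    filter_upwards [hzz, hz0, P.coeFn_compLp z'] with t h1 h2 h3 h4
    rw [h3, h1 h4, h2 h4])
  filter_upwards [this, hd, P.coeFn_compLp d] with t h1 h2 h3 h4
  rw [← h2 h4, ← h3, h1 h4]

end IsGalerkinSystem

section Equations

variable {A : ℂ → X →L[ℂ] X →L⋆[ℂ] ℂ} {Xh : Submodule ℂ X} [FiniteDimensional ℂ Xh]
  {B : ℂ → X →L[ℂ] X} {σ₀ σ T : ℝ} {φ : ℝ → X} {g : ℝ → X →L⋆[ℂ] ℂ} {w q z p : LTwo X}

theorem VanishesBefore.sub {V : Type*} [NormedAddCommGroup V] {a : ℝ} {y y' : LTwo V}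
    (h : VanishesBefore a y) (h' : VanishesBefore a y') : VanishesBefore a (y - y') := by
  filter_upwards [h, h', Lp.coeFn_sub y y'] with t h1 h2 h3 h4
  rw [h3, Pi.sub_apply, h1 h4, h2 h4, sub_zero]

theorem vanishesBefore_residual (hσ₀ : 0 < σ₀) (hσ : σ₀ < σ)
    (hA : IsDecaying σ₀ fun s => (s ^ 4)⁻¹ • rieszSymbol A s)
    (hw : IsWeighted σ T φ w) (hq : IsWeighted σ T (fun t => antidualEquiv X (g t)) q)
    (hz : IsMul σ (fun s => (s ^ 4)⁻¹ • rieszSymbol A s) w z)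
    (hp : IsMul σ (fun s => (s ^ 4)⁻¹ • ContinuousLinearMap.id ℂ X) q p) :
    VanishesBefore 0 (z - p) :=
  (hA.vanishesBefore hσ hz hw.vanishesBefore).sub
    ((isSymbol_inv_pow X hσ₀ 4).vanishesBefore hσ hp hq.vanishesBefore)

theorem isDecaying_rieszSymbol (hA : IsDecaying σ₀ fun s => (s ^ 4)⁻¹ • A s) :
    IsDecaying σ₀ fun s => (s ^ 4)⁻¹ • rieszSymbol A s := by
  obtain ⟨C, hC, hb⟩ := hA.decay
  set R := ((antidualEquiv X).toContinuousLinearEquiv : (X →L⋆[ℂ] ℂ) →L[ℂ] X)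
  have e : ∀ s, (s ^ 4)⁻¹ • rieszSymbol A s = R ∘L ((s ^ 4)⁻¹ • A s) := fun s => by
    rw [ContinuousLinearMap.comp_smul]; rfl
  refine ⟨?_, C, hC, fun s hs => ?_⟩
  · simp only [e]
    exact (differentiableOn_const R).clm_comp hA.differentiableOn
  · rw [e]
    exact (norm_antidualEquiv_comp_le _).trans (hb s hs)

theorem IsSolution.vanishesBefore (hσ₀ : 0 < σ₀) (hσ : σ₀ < σ) (h1 : σ₀ < 1)
    (hA : IsDecaying σ₀ fun s => (s ^ 4)⁻¹ • A s) (h : IsSolution T A g φ)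
    (hw : IsWeighted σ T φ w) (hq : IsWeighted σ T (fun t => antidualEquiv X (g t)) q)
    (hz : IsMul σ (fun s => (s ^ 4)⁻¹ • rieszSymbol A s) w z)
    (hp : IsMul σ (fun s => (s ^ 4)⁻¹ • ContinuousLinearMap.id ℂ X) q p) :
    VanishesBefore T (z - p) := by
  refine vanishesBefore_of_forall_integral_eq_zero (σ := σ) 4
    (vanishesBefore_residual hσ₀ hσ (isDecaying_rieszSymbol hA) hw hq hz hp) fun η hη => ?_
  rw [← residual_eq_integral (antidualEquiv X) hσ₀ hσ h1 hA hw hq hz hp hη, h η hη, sub_self,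
    map_zero]

/-- Nothing is known of `g` beyond $T$; integrability on $(0,\infty)$ holds because $\eta$ vanishes
there. -/
theorem integral_apply_antidual (hg : MemLp ((Set.Ioo 0 T).indicator g) 2 (volume : Measure ℝ))
    {η : ℝ → ℝ} (hη : IsTestFunction T η) (χ : X) :
    (∫ t in Set.Ioi 0, η t • g t) χ = ∫ t in Set.Ioi 0, η t • g t χ := by
  have hloc : LocallyIntegrable ((Set.Ioo 0 T).indicator g) := hg.locallyIntegrable (by norm_num)
  have h1 := (hloc.integrable_smul_left_of_hasCompactSupport hη.1.continuous hη.2.1).integrableOn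
    (s := Set.Ioi 0)
  have h2 : IntegrableOn (fun t => η t • g t) (Set.Ioi 0) := by
    refine h1.congr_fun (fun t ht => ?_) measurableSet_Ioi
    rcases lt_or_ge t T with htT | htT
    · simp only [Set.indicator_of_mem (Set.mem_Ioo.2 ⟨ht, htT⟩)]
    · have := iteratedDeriv_eq_zero_of_le hη 0 htT
      rw [iteratedDeriv_zero] at this
      simp only [this]
      exact (zero_smul ℝ ((Set.Ioo 0 T).indicator g t)).trans (zero_smul ℝ (g t)).symm
  let ev : (X →L⋆[ℂ] ℂ) →L[ℂ] ℂ := innerSL ℂ χ ∘L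
    ((antidualEquiv X).toContinuousLinearEquiv : (X →L⋆[ℂ] ℂ) →L[ℂ] X)
  have hev : ∀ f, ev f = f χ := fun f => inner_antidualEquiv χ f
  rw [← hev, ← ev.integral_comp_comm h2]
  simp only [hev]
  rfl

/-- Testing with all $\chi\in\mathcal X_h$ says that the time-tested residual is orthogonal to
$\mathcal X_h$, that is, annihilated by the projection, which commutes with the time integral. -/
theorem isGalerkin_iff (hσ₀ : 0 < σ₀) (hσ : σ₀ < σ) (h1 : σ₀ < 1)
    (hA : IsDecaying σ₀ fun s => (s ^ 4)⁻¹ • A s)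
    (hg : MemLp ((Set.Ioo 0 T).indicator g) 2 (volume : Measure ℝ))
    (hw : IsWeighted σ T φ w) (hq : IsWeighted σ T (fun t => antidualEquiv X (g t)) q)
    (hz : IsMul σ (fun s => (s ^ 4)⁻¹ • rieszSymbol A s) w z)
    (hp : IsMul σ (fun s => (s ^ 4)⁻¹ • ContinuousLinearMap.id ℂ X) q p) :
    (∀ χ ∈ Xh, ∀ η : ℝ → ℝ, IsTestFunction T η →
      convDistribution 4 A φ η χ = ∫ t in Set.Ioi 0, η t • g t χ) ↔
    ∀ᵐ t : ℝ, t < T → Xh.starProjection ((z - p) t) = 0 := by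
  set P := Xh.starProjection
  set y : LTwo X := P.compLp (z - p)
  have hy : ∀ᵐ t, y t = P ((z - p) t) := P.coeFn_compLp _
  have hy0 : VanishesBefore 0 y := by
    filter_upwards [hy, vanishesBefore_residual hσ₀ hσ (isDecaying_rieszSymbol hA) hw hq hz hp]
      with t h2 h3 h4
    rw [h2, h3 h4, map_zero]
  have key : ∀ η, IsTestFunction T η →
      ∫ t, (Real.exp (σ * t) * iteratedDeriv 4 η t) • y t
        = P (antidualEquiv X (convDistribution 4 A φ η - ∫ t in Set.Ioi 0, η t • g t)) := by
    intro η hη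
    have hc : Continuous fun t => Real.exp (σ * t) * iteratedDeriv 4 η t :=
      (by fun_prop : Continuous fun t => Real.exp (σ * t)).mul
        (hη.1.continuous_iteratedDeriv 4 (by norm_cast))
    have hcs : HasCompactSupport fun t => Real.exp (σ * t) * iteratedDeriv 4 η t := by
      refine HasCompactSupport.mul_left ?_
      refine HasCompactSupport.of_support_subset_isCompact hη.2.1 ?_
      intro t ht
      by_contra h
      exact ht (iteratedDeriv_eq_zero_of_notMem_tsupport 4 h)
    rw [residual_eq_integral (antidualEquiv X) hσ₀ hσ h1 hA hw hq hz hp hη,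
      ← P.integral_comp_comm ((LTwo.locallyIntegrable (z - p)).integrable_smul_left_of_hasCompactSupport
        hc hcs)]
    refine integral_congr_ae (hy.mono fun t ht => ?_)
    simp only [ht]
    exact (P.map_smul_of_tower _ _).symm
  have hzero : (∀ χ ∈ Xh, ∀ η : ℝ → ℝ, IsTestFunction T η →
      convDistribution 4 A φ η χ = ∫ t in Set.Ioi 0, η t • g t χ) ↔
      ∀ η, IsTestFunction T η → ∫ t, (Real.exp (σ * t) * iteratedDeriv 4 η t) • y t = 0 := by
    have h2 : ∀ η, IsTestFunction T η → ∀ χ,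
        (convDistribution 4 A φ η χ = ∫ t in Set.Ioi 0, η t • g t χ ↔
          inner ℂ χ (antidualEquiv X
            (convDistribution 4 A φ η - ∫ t in Set.Ioi 0, η t • g t)) = 0) := by
      intro η hη χ
      rw [inner_antidualEquiv, ← integral_apply_antidual hg hη, ← sub_eq_zero]
      rfl
    constructor
    · intro h η hη
      rw [key η hη, Submodule.starProjection_apply_eq_zero_iff, Submodule.mem_orthogonal]
      exact fun χ hχ => (h2 η hη χ).1 (h χ hχ η hη)
    · intro h χ hχ η hη
      have h3 := h η hη
      rw [key η hη, Submodule.starProjection_apply_eq_zero_iff, Submodule.mem_orthogonal] at h3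
      exact (h2 η hη χ).2 (h3 χ hχ)
  rw [hzero]
  constructor
  · intro h
    filter_upwards [vanishesBefore_of_forall_integral_eq_zero 4 hy0 h, hy] with t h2 h3 h4
    rw [← h3, h2 h4]
  · intro h η hη
    refine integral_eq_zero_of_ae ?_
    filter_upwards [h, hy] with t h2 h3
    rcases lt_or_ge t T with htT | htT
    · simp only [h3, h2 htT, smul_zero, Pi.zero_apply]
    · simp [iteratedDeriv_eq_zero_of_le hη 4 htT]

end Equations

end GalerkinSystem

/-! ### Existence, uniqueness and error of the Galerkin solution -/

section GalerkinSolution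

set_option linter.unusedSectionVars false

open FourierTransform Filter Topology

/-- What remains is $|s|^{-2}$, and $|s|>\sigma_0$ gives
$1+(\operatorname{Im}s)^2\le(1+\sigma_0^{-2})|s|^2$. -/
theorem isDecaying_of_quadratic_growth {V : Type*} [NormedAddCommGroup V] [NormedSpace ℂ V]
    {σ₀ M : ℝ} (hσ₀ : 0 < σ₀) {S : ℂ → V} (hS : DifferentiableOn ℂ S {s : ℂ | σ₀ < s.re})
    (hM : ∀ s : ℂ, σ₀ < s.re → ‖S s‖ ≤ M * ‖s‖ ^ 2) :
    IsDecaying σ₀ fun s => (s ^ 4)⁻¹ • S s := by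
  refine ⟨(differentiableOn_inv_pow hσ₀.le 4).smul hS, |M| * (1 + (σ₀ ^ 2)⁻¹), by positivity,
    fun s hs => ?_⟩
  have h0 : σ₀ < ‖s‖ := hs.trans_le (Complex.re_le_norm s)
  have h1 : 0 < ‖s‖ := hσ₀.trans h0
  have h2 : 1 + s.im ^ 2 ≤ (1 + (σ₀ ^ 2)⁻¹) * ‖s‖ ^ 2 := by
    have e1 : s.im ^ 2 ≤ ‖s‖ ^ 2 := by
      rw [← sq_abs]; gcongr; exact Complex.abs_im_le_norm s
    have e2 : 1 ≤ (σ₀ ^ 2)⁻¹ * ‖s‖ ^ 2 := by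
      rw [inv_mul_eq_div, one_le_div (by positivity)]
      gcongr
    linarith
  rw [norm_smul, norm_inv, norm_pow, ← div_eq_mul_inv, inv_mul_eq_div,
    div_le_div_iff₀ (by positivity) (by positivity)]
  calc ‖S s‖ * (1 + s.im ^ 2) ≤ (|M| * ‖s‖ ^ 2) * ((1 + (σ₀ ^ 2)⁻¹) * ‖s‖ ^ 2) := by
        gcongr
        exact (hM s hs).trans (by gcongr; exact le_abs_self M)
    _ = _ := by ring

variable {X : Type*} [NormedAddCommGroup X] [InnerProductSpace ℂ X] [CompleteSpace X]

theorem exists_isGalerkinSystem {A : ℂ → X →L[ℂ] X →L⋆[ℂ] ℂ} {M α : ℝ → ℝ}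
    (hA : DifferentiableOn ℂ A {s : ℂ | 0 < s.re})
    (hM : ∀ σ : ℝ, 0 < σ → ∀ s : ℂ, σ ≤ s.re → ‖A s‖ ≤ M σ * ‖s‖ ^ 2)
    (hα : ∀ σ : ℝ, 0 < σ → 0 < α σ)
    (hc : ∀ σ : ℝ, 0 < σ → ∀ s : ℂ, σ ≤ s.re → ∀ x : X,
      α σ * ‖s⁻¹ • x‖ ^ 2 ≤ (A s x x).re)
    (Xh : Submodule ℂ X) [FiniteDimensional ℂ Xh] {σ₀ : ℝ} (hσ₀ : 0 < σ₀) :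
    ∃ B : ℂ → X →L[ℂ] X, IsGalerkinSystem σ₀ (rieszSymbol A) B Xh.starProjection ∧
      ∀ σ : ℝ, 0 < σ → ∀ s : ℂ, σ ≤ s.re → ‖B s‖ ≤ ‖s‖ ^ 2 / α σ := by
  have hD : DifferentiableOn ℂ (rieszSymbol A) {s : ℂ | 0 < s.re} :=
    (differentiableOn_const _).clm_comp hA
  obtain ⟨B, hB, hBn, hBP⟩ := exists_galerkinInverse Xh hD hα (fun σ hσ s hs x => by
    rw [inner_rieszSymbol]; exact hc σ hσ s hs x)
  have hsub : {s : ℂ | σ₀ < s.re} ⊆ {s : ℂ | 0 < s.re} := fun s hs => hσ₀.trans hs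
  have hpos : ∀ s : ℂ, σ₀ < s.re → 0 < s.re := fun s hs => hσ₀.trans hs
  have hM' : ∀ s : ℂ, σ₀ < s.re → ‖rieszSymbol A s‖ ≤ M σ₀ * ‖s‖ ^ 2 := fun s hs =>
    (norm_antidualEquiv_comp_le (A s)).trans (hM σ₀ hσ₀ s hs.le)
  have hα₀ := hα σ₀ hσ₀
  refine ⟨B, ⟨⟨hD.mono hsub, |M σ₀|, 2, abs_nonneg _, fun s hs => ?_⟩,
    ⟨hB.mono hsub, (α σ₀)⁻¹, 2, by positivity, fun s hs => ?_⟩,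
    isDecaying_of_quadratic_growth hσ₀ (hD.mono hsub) hM',
    fun s hs => (hBP s (hpos s hs)).1, fun s hs => (hBP s (hpos s hs)).2.1,
    fun s hs => (hBP s (hpos s hs)).2.2.1, fun s hs => (hBP s (hpos s hs)).2.2.2⟩, hBn⟩
  · calc ‖rieszSymbol A s‖ ≤ M σ₀ * ‖s‖ ^ 2 := hM' s hs
      _ ≤ |M σ₀| * ‖s‖ ^ 2 := by gcongr; exact le_abs_self _
      _ ≤ |M σ₀| * (1 + ‖s‖) ^ 2 := by gcongr; linarith
  · refine (hBn σ₀ hσ₀ s hs.le).trans ?_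
    rw [div_eq_inv_mul]
    gcongr
    linarith

theorem norm_le_norm_one_add {s : ℂ} (hs : 0 ≤ s.re) : ‖s‖ ≤ ‖1 + s‖ := by
  rw [Complex.norm_def, Complex.norm_def]
  apply Real.sqrt_le_sqrt
  simp only [Complex.normSq_apply, Complex.add_re, Complex.add_im, Complex.one_re, Complex.one_im]
  nlinarith

theorem norm_shiftPow_neg_natCast (n : ℕ) (s : ℂ) :
    ‖shiftPow (-n) s‖ = (‖1 + s‖ ^ n)⁻¹ := by
  rw [norm_shiftPow, Real.rpow_neg (norm_nonneg _), Real.rpow_natCast]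

variable {A : ℂ → X →L[ℂ] X →L⋆[ℂ] ℂ} {Xh : Submodule ℂ X} [FiniteDimensional ℂ Xh]
  {B : ℂ → X →L[ℂ] X} {σ₀ σ T m : ℝ} {φ : ℝ → X} {g : ℝ → X →L⋆[ℂ] ℂ}

theorem IsCausalExtension.memHZero {V : Type*} [NormedAddCommGroup V] [NormedSpace ℂ V]
    [CompleteSpace V] {r : ℝ} {f : ℝ → V} {G v : LTwo V} (h : IsCausalExtension r T f G v) :
    MemHZero r T f := ⟨G, v, h⟩

theorem MemHZero.exists_isWeighted_antidual {r : ℝ} (h : MemHZero r T g) (hσ : 0 ≤ σ) :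
    ∃ q : LTwo X, IsWeighted σ T (fun t => antidualEquiv X (g t)) q := by
  obtain ⟨G, v, hGv⟩ := h
  obtain ⟨G', v', h', -⟩ := hGv.comp_linearIsometryEquiv (antidualEquiv X)
  exact exists_isWeighted hσ h'.memHZero.memLp_indicator

theorem exists_isMul_inv_pow {E : Type*} [NormedAddCommGroup E] [InnerProductSpace ℂ E]
    [CompleteSpace E] (hσ₀ : 0 < σ₀) (hσ : σ₀ < σ) (k : ℕ) (w : LTwo E) :
    ∃ z : LTwo E, IsMul σ (fun s => (s ^ k)⁻¹ • ContinuousLinearMap.id ℂ E) w z := by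
  obtain ⟨z, hz, -⟩ := (isSymbol_inv_pow E hσ₀ k).exists_isMul hσ (K := (σ₀ ^ k)⁻¹)
    (fun s hs => by
      rw [norm_smul]
      refine (mul_le_of_le_one_right (norm_nonneg _) ContinuousLinearMap.norm_id_le).trans ?_
      exact norm_inv_pow_le hσ₀ k (by rw [hs]; exact hσ.le)) w
  exact ⟨z, hz⟩

theorem IsWeighted.ae_eq_of_vanishesBefore {V : Type*} [NormedAddCommGroup V] [NormedSpace ℂ V]
    {f : ℝ → V} {w x : LTwo V} (hw : IsWeighted σ T f w) (hx : VanishesBefore 0 x)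
    (hxf : ∀ᵐ t : ℝ, 0 < t → t < T → x t = Complex.exp (-(σ * t : ℝ)) • f t) :
    ∀ᵐ t, t < T → w t = x t := by
  filter_upwards [hw.eq_smul, hw.eq_zero, hx, hxf, Measure.ae_ne volume (0 : ℝ)]
    with t h1 h2 h3 h4 h5 h6
  rcases lt_or_gt_of_ne h5 with h | h
  · rw [h2 fun h7 => h.not_gt h7.1, h3 h]
  · rw [h1 h h6, h4 h h6]

/-- The solution is $B(\partial_t)g$. If $g$ has density $y$ of order $m+2$, then $z=(1+s)^{-2}By$
is a density of order $m$ for it, and $|s|\le|1+s|$ bounds that symbol by `K`. -/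
theorem exists_isGalerkinSolution
    (hsys : IsGalerkinSystem σ₀ (rieszSymbol A) B Xh.starProjection) (hσ₀ : 0 < σ₀) (hσ : σ₀ < σ)
    (h1 : σ₀ < 1) (hA : IsDecaying σ₀ fun s => (s ^ 4)⁻¹ • A s) {K : ℝ} (hK : 0 ≤ K)
    (hB : ∀ s : ℂ, s.re = σ → ‖B s‖ ≤ K * ‖s‖ ^ 2) (hm : 0 ≤ m) {G v : LTwo (X →L⋆[ℂ] ℂ)}
    (hg : IsCausalExtension (m + 2) T g G v) :
    ∃ (f : ℝ → X) (Gf vf : LTwo X), IsCausalExtension m T f Gf vf ∧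
      IsGalerkinSolution T A Xh g f ∧
      ‖vf‖ ≤ Real.exp (σ * T) * (K * ((2 * Real.pi) ^ (m + 2) * ‖v‖)) := by
  have hσp : 0 < σ := hσ₀.trans hσ
  have hhalf : -(1 / 2 : ℝ) ≤ σ₀ := by linarith
  set P := Xh.starProjection with hPdef
  obtain ⟨G', v', hg', hv'⟩ := hg.comp_linearIsometryEquiv (antidualEquiv X)
  obtain ⟨y, x, hy0, hyn, hx0, hyx, hxg⟩ := hg'.exists_density (by linarith) hσp
  have hsymB : IsSymbol σ₀ fun s => shiftPow (-2) s • B s :=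
    hsys.isSymbol_inverse.smul (differentiableOn_shiftPow hhalf) (shiftPow_growth hhalf)
  have hsymJ := isSymbol_shiftPow X (-m) hhalf
  obtain ⟨z, hyz, hzn⟩ := hsymB.exists_isMul hσ (K := K) (fun s hs => by
    have hs0 : 0 ≤ s.re := by rw [hs]; exact hσp.le
    have hn : 0 < ‖1 + s‖ := by
      have := half_lt_norm_one_add (s := s) (by linarith)
      linarith
    rw [norm_smul, show (-2 : ℝ) = -((2 : ℕ) : ℝ) by norm_num, norm_shiftPow_neg_natCast,
      inv_mul_eq_div, div_le_iff₀ (by positivity)]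
    refine (hB s hs).trans ?_
    gcongr
    exact norm_le_norm_one_add hs0) y
  obtain ⟨x₂, hzx, -⟩ := hsymJ.exists_isMul hσ (K := 1) (fun s hs => by
    rw [norm_smul]
    exact mul_le_one₀ (norm_shiftPow_neg_le_one hm (by rw [hs]; exact hσp.le)) (norm_nonneg _)
      ContinuousLinearMap.norm_id_le) z
  have hz0 := hsymB.vanishesBefore hσ hyz hy0
  have hx₂0 := hsymJ.vanishesBefore hσ hzx hz0
  set f : ℝ → X := fun t => Complex.exp (σ * t : ℝ) • x₂ t
  have hf : ∀ t : ℝ, x₂ t = Complex.exp (-(σ * t : ℝ)) • f t := fun t => by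
    simp only [f, smul_smul, ← Complex.exp_add]
    simp
  obtain ⟨Gf, vf, hext, hvf⟩ := exists_isCausalExtension_of_density (T := T) (f := f) hm hσp hz0 hzx
    (Eventually.of_forall fun t _ _ => hf t)
  obtain ⟨w, hw⟩ := exists_isWeighted hσp.le hext.memHZero.memLp_indicator
  obtain ⟨q, hq⟩ := hg.memHZero.exists_isWeighted_antidual hσp.le
  obtain ⟨zw, hzw⟩ := hsys.exists_isMul hσ w
  obtain ⟨z₂, hz₂⟩ := hsys.exists_isMul hσ x₂
  obtain ⟨p, hp⟩ := exists_isMul_inv_pow hσ₀ hσ 4 q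
  obtain ⟨p₂, hp₂⟩ := exists_isMul_inv_pow hσ₀ hσ 4 x
  -- The zero extensions agree with the untruncated functions only before $T$; causality passes this
  -- agreement on to the outputs, so the equation can be checked on the untruncated ones.
  have hwx := hw.ae_eq_of_vanishesBefore hx₂0 (Eventually.of_forall fun t _ _ => hf t)
  have hqx := hq.ae_eq_of_vanishesBefore hx0 hxg
  have hzz := hzw.eqOn_of_vanishesBefore hz₂ hsys.isDecaying.isSymbol hσ hwx
  have hpp := hp.eqOn_of_vanishesBefore hp₂ (isSymbol_inv_pow X hσ₀ 4) hσ hqx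
  have hre : ∀ ξ, σ₀ < (line σ ξ).re := fun ξ => by rwa [line_re]
  have hPx : P.compLp x₂ = x₂ := by
    apply ae_eq_of_fourier_ae_eq
    filter_upwards [fourier_clm_apply P (P.coeFn_compLp x₂), hyz, hzx] with ξ e1 e2 e3
    have e4 := congrArg (fun l => l ((𝓕 y : LTwo X) ξ)) (hsys.proj_inverse _ (hre ξ))
    simp only [ContinuousLinearMap.comp_apply] at e4
    rw [e1, e3, e2]
    simp only [smul_apply, map_smul, ContinuousLinearMap.id_apply, e4]
  -- This is $PDB=P$, combined with $(1+s)^{-m}(1+s)^{-2}=(1+s)^{-(m+2)}$.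
  have hPz : P.compLp z₂ = P.compLp p₂ := by
    apply ae_eq_of_fourier_ae_eq
    filter_upwards [fourier_clm_apply P (P.coeFn_compLp z₂),
      fourier_clm_apply P (P.coeFn_compLp p₂), hyz, hzx, hz₂, hp₂, hyx] with ξ e1 e2 e3 e4 e5 e6 e7
    have e8 := congrArg (fun l => l ((𝓕 y : LTwo X) ξ)) (hsys.proj_comp_inverse _ (hre ξ))
    simp only [ContinuousLinearMap.comp_apply] at e8
    rw [e1, e2, e5, e6, e4, e3, e7]
    simp only [smul_apply, map_smul, ContinuousLinearMap.id_apply, e8]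
    rw [show -(m + 2) = -m + -2 by ring, shiftPow_add (by linarith [hre ξ]), smul_smul, smul_smul,
      smul_smul]
    congr 1
    ring
  refine ⟨f, Gf, vf, hext, ⟨?_, ?_⟩, ?_⟩
  · have := P.coeFn_compLp x₂
    rw [hPx] at this
    filter_upwards [this] with t ht _ _
    refine Xh.smul_mem _ ?_
    rw [ht]
    exact Xh.starProjection_apply_mem _
  · rw [isGalerkin_iff hσ₀ hσ h1 hA hg.memHZero.memLp_indicator hw hq hzw hp]
    have e1 := P.coeFn_compLp z₂
    rw [hPz] at e1
    filter_upwards [e1, P.coeFn_compLp p₂, hzz, hpp, Lp.coeFn_sub zw p] with t g1 g2 g3 g4 g5 g6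
    rw [g5, Pi.sub_apply, g3 g6, g4 g6, map_sub, ← g1, ← g2, sub_self]
  · rw [← hv']
    calc ‖vf‖ ≤ Real.exp (σ * T) * ‖z‖ := hvf
      _ ≤ Real.exp (σ * T) * (K * ‖y‖) := by gcongr
      _ ≤ _ := by gcongr

/-- The Galerkin solution is unique. -/
theorem IsGalerkinSolution.ae_eq
    (hsys : IsGalerkinSystem σ₀ (rieszSymbol A) B Xh.starProjection) (hσ₀ : 0 < σ₀) (hσ : σ₀ < σ)
    (h1 : σ₀ < 1) (hA : IsDecaying σ₀ fun s => (s ^ 4)⁻¹ • A s) {r r' : ℝ} {f f' : ℝ → X}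
    (hg : MemHZero r T g) (hf : MemHZero r' T f) (hf' : MemHZero r' T f')
    (h : IsGalerkinSolution T A Xh g f) (h' : IsGalerkinSolution T A Xh g f') :
    ∀ᵐ t : ℝ, 0 < t → t < T → f t = f' t := by
  have hσp : 0 < σ := hσ₀.trans hσ
  obtain ⟨w, hw⟩ := exists_isWeighted hσp.le hf.memLp_indicator
  obtain ⟨w', hw'⟩ := exists_isWeighted hσp.le hf'.memLp_indicator
  obtain ⟨q, hq⟩ := hg.exists_isWeighted_antidual hσp.le
  obtain ⟨z, hz⟩ := hsys.exists_isMul hσ w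
  obtain ⟨z', hz'⟩ := hsys.exists_isMul hσ w'
  obtain ⟨p, hp⟩ := exists_isMul_inv_pow hσ₀ hσ 4 q
  have e := (isGalerkin_iff hσ₀ hσ h1 hA hg.memLp_indicator hw hq hz hp).1 h.2
  have e' := (isGalerkin_iff hσ₀ hσ h1 hA hg.memLp_indicator hw' hq hz' hp).1 h'.2
  have hd := hsys.vanishesBefore (T := T) hσ₀ hσ (d := w - w') (z := z - z') (by
    filter_upwards [hw, hw', Lp.coeFn_sub w w', h.1, h'.1] with t g1 g2 g3 g4 g5 _
    rw [g3, Pi.sub_apply, g1, g2]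
    by_cases ht : t ∈ Set.Ioo 0 T
    · rw [Set.indicator_of_mem ht, Set.indicator_of_mem ht, Submodule.starProjection_eq_self_iff]
      exact Xh.sub_mem (Xh.smul_mem _ (g4 ht.1 ht.2)) (Xh.smul_mem _ (g5 ht.1 ht.2))
    · simp [ht]) (hz.sub hz') (by
    filter_upwards [e, e', Lp.coeFn_sub z p, Lp.coeFn_sub z' p, Lp.coeFn_sub z z']
      with t g1 g2 g3 g4 g5 g6
    have g1 := g1 g6
    have g2 := g2 g6
    rw [g3, Pi.sub_apply, map_sub, sub_eq_zero] at g1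
    rw [g4, Pi.sub_apply, map_sub, sub_eq_zero] at g2
    rw [g5, Pi.sub_apply, map_sub, g1, g2, sub_self])
  filter_upwards [hd, hw.eq_smul, hw'.eq_smul, Lp.coeFn_sub w w'] with t g1 g2 g3 g4 g5 g6
  have := g1 g6
  rw [g4, Pi.sub_apply, g2 g5 g6, g3 g5 g6, sub_eq_zero] at this
  exact smul_right_injective X (Complex.exp_ne_zero _) this

/-- With $x$ the weighted $P\phi-\phi$, put $x_3=(I-BD)x$. Before $T$, $d=\phi_h-\phi-x_3$
(weighted) equals $\phi_h-P\phi+BDx$, which takes values in $\mathcal X_h$, and $PD(I-BD)=0$ makes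
it a solution of the homogeneous Galerkin equation. Hence $d=0$. The symbol $BD$ is applied only to
$P\phi-\phi$, never to $\phi$ itself. -/
theorem IsGalerkinSolution.exists_error_extension
    (hsys : IsGalerkinSystem σ₀ (rieszSymbol A) B Xh.starProjection) (hσ₀ : 0 < σ₀) (hσ : σ₀ < σ)
    (h1 : σ₀ < 1) (hA : IsDecaying σ₀ fun s => (s ^ 4)⁻¹ • A s) {K : ℝ}
    (hK : ∀ s : ℂ, s.re = σ → 1 + ‖B s ∘L rieszSymbol A s‖ ≤ K * ‖1 + s‖ ^ 4)
    (hm : 0 ≤ m) {r : ℝ} {f : ℝ → X}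
    (hg : MemHZero r T g) (hf : MemHZero m T f) (hφ : MemHZero m T φ)
    (h : IsGalerkinSolution T A Xh g f) (h' : IsSolution T A g φ) {G v : LTwo X}
    (he : IsCausalExtension (m + 4) T (fun t => Xh.starProjection (φ t) - φ t) G v) :
    ∃ G' v' : LTwo X, IsCausalExtension m T (fun t => f t - φ t) G' v' ∧
      ‖v'‖ ≤ Real.exp (σ * T) * (K * ((2 * Real.pi) ^ (m + 4) * ‖v‖)) := by
  have hσp : 0 < σ := hσ₀.trans hσ
  have hhalf : -(1 / 2 : ℝ) ≤ σ₀ := by linarith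
  set P := Xh.starProjection with hPdef
  set D := rieszSymbol A
  have hK0 : 0 ≤ K := by
    have e1 := hK (σ : ℂ) (by simp)
    by_contra hneg
    have : K * ‖1 + (σ : ℂ)‖ ^ 4 ≤ 0 := mul_nonpos_of_nonpos_of_nonneg (by linarith) (by positivity)
    linarith [norm_nonneg (B σ ∘L D σ)]
  obtain ⟨w, hw⟩ := exists_isWeighted hσp.le hf.memLp_indicator
  obtain ⟨u, hu⟩ := exists_isWeighted hσp.le hφ.memLp_indicator
  obtain ⟨q, hq⟩ := hg.exists_isWeighted_antidual hσp.le
  obtain ⟨zw, hzw⟩ := hsys.exists_isMul hσ w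
  obtain ⟨zu, hzu⟩ := hsys.exists_isMul hσ u
  obtain ⟨p, hp⟩ := exists_isMul_inv_pow hσ₀ hσ 4 q
  have e := (isGalerkin_iff hσ₀ hσ h1 hA hg.memLp_indicator hw hq hzw hp).1 h.2
  have e' := h'.vanishesBefore hσ₀ hσ h1 hA hu hq hzu hp
  obtain ⟨y, x, hy0, hyn, hx0, hyx, hxe⟩ := he.exists_density (by linarith) hσp
  -- The four extra orders of the density of $P\phi-\phi$ compensate the growth $|s|^4$ of $BD$.
  have hsymQ : IsSymbol σ₀ fun s => shiftPow (-4) s • (ContinuousLinearMap.id ℂ X - B s ∘L D s) :=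
    ((isSymbol_const σ₀ _).sub (hsys.isSymbol_inverse.comp hsys.isSymbol_left)).smul
      (differentiableOn_shiftPow hhalf) (shiftPow_growth hhalf)
  have hsymJ := isSymbol_shiftPow X (-m) hhalf
  obtain ⟨y₂, hyy, hyyn⟩ := hsymQ.exists_isMul hσ (K := K) (fun s hs => by
    have hn : 0 < ‖1 + s‖ := by
      have := half_lt_norm_one_add (s := s) (by linarith)
      linarith
    rw [norm_smul, show (-4 : ℝ) = -((4 : ℕ) : ℝ) by norm_num, norm_shiftPow_neg_natCast,
      inv_mul_eq_div, div_le_iff₀ (by positivity)]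
    refine ((norm_sub_le _ _).trans ?_).trans (hK s hs)
    gcongr
    exact ContinuousLinearMap.norm_id_le) y
  obtain ⟨x₃, hyx₃, -⟩ := hsymJ.exists_isMul hσ (K := 1) (fun s hs => by
    rw [norm_smul]
    exact mul_le_one₀ (norm_shiftPow_neg_le_one hm (by rw [hs]; exact hσp.le)) (norm_nonneg _)
      ContinuousLinearMap.norm_id_le) y₂
  have hy₂0 := hsymQ.vanishesBefore hσ hyy hy0
  have hx₃0 := hsymJ.vanishesBefore hσ hyx₃ hy₂0
  have hre : ∀ ξ, σ₀ < (line σ ξ).re := fun ξ => by rwa [line_re]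
  have hx₃ : ∀ᵐ ξ, (𝓕 x₃ : LTwo X) ξ
      = (𝓕 x : LTwo X) ξ - B (line σ ξ) (D (line σ ξ) ((𝓕 x : LTwo X) ξ)) := by
    filter_upwards [hyy, hyx₃, hyx] with ξ g1 g2 g3
    rw [g2, g1, g3]
    simp only [smul_apply, sub_apply, ContinuousLinearMap.id_apply, ContinuousLinearMap.comp_apply,
      map_smul, smul_sub, smul_smul]
    rw [show -(m + 4) = -m + -4 by ring, shiftPow_add (by linarith [hre ξ])]
  have hPb : P.compLp (x - x₃) = x - x₃ := by
    apply ae_eq_of_fourier_ae_eq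
    filter_upwards [fourier_clm_apply P (P.coeFn_compLp (x - x₃)), hx₃, fourier_lp_sub x x₃]
      with ξ g1 g2 g3
    have g4 := congrArg (fun l => l (D (line σ ξ) ((𝓕 x : LTwo X) ξ)))
      (hsys.proj_inverse _ (hre ξ))
    simp only [ContinuousLinearMap.comp_apply] at g4
    rw [g1, g3, g2, sub_sub_cancel, g4]
  obtain ⟨z₃, hz₃⟩ := hsys.exists_isMul hσ x₃
  have hPz₃ : P.compLp z₃ = 0 := by
    apply ae_eq_of_fourier_ae_eq
    have h0 : (𝓕 (0 : LTwo X) : LTwo X) = 0 := (Lp.fourierTransformₗᵢ ℝ X).map_zero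
    rw [h0]
    filter_upwards [fourier_clm_apply P (P.coeFn_compLp z₃), hz₃, hx₃,
      Lp.coeFn_zero X 2 (volume : Measure ℝ)] with ξ g1 g2 g3 g4
    have g5 := congrArg (fun l => l (D (line σ ξ) ((𝓕 x : LTwo X) ξ)))
      (hsys.proj_comp_inverse _ (hre ξ))
    simp only [ContinuousLinearMap.comp_apply] at g5
    rw [g1, g2, g3, g4]
    simp only [smul_apply, map_smul, map_sub, Pi.zero_apply]
    rw [g5, sub_self]
  have hxu : ∀ᵐ t, t < T → x t = P (u t) - u t := by
    filter_upwards [hxe, hx0, hu.eq_smul, hu.eq_zero, Measure.ae_ne volume (0 : ℝ)]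
      with t g1 g2 g3 g4 g5 g6
    rcases lt_or_gt_of_ne g5 with h | h
    · rw [g2 h, g4 fun h7 => h.not_gt h7.1, map_zero, sub_zero]
    · rw [g1 h g6, g3 h g6, map_smul, smul_sub]
  have hd := hsys.vanishesBefore (T := T) hσ₀ hσ (d := w - u - x₃) (z := zw - zu - z₃) (by
    have hb := P.coeFn_compLp (x - x₃)
    rw [hPb] at hb
    filter_upwards [hw, h.1, Lp.coeFn_sub (w - u) x₃, Lp.coeFn_sub w u, Lp.coeFn_sub x x₃, hxu, hb]
      with t g1 g2 g3 g4 g5 g6 g7 g8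
    have hPw : P (w t) = w t := by
      rw [g1]
      by_cases ht : t ∈ Set.Ioo 0 T
      · rw [Set.indicator_of_mem ht, Submodule.starProjection_eq_self_iff]
        exact Xh.smul_mem _ (g2 ht.1 ht.2)
      · simp [ht]
    have hPP : P (P (u t)) = P (u t) :=
      Submodule.starProjection_eq_self_iff.2 (Xh.starProjection_apply_mem _)
    have e1 : (w - u - x₃ : LTwo X) t = w t - P (u t) + (x - x₃ : LTwo X) t := by
      rw [g3, Pi.sub_apply, g4, Pi.sub_apply, g5, Pi.sub_apply, g6 g8]
      abel
    rw [e1, map_add, map_sub, hPw, hPP, ← g7])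
    ((hzw.sub hzu).sub hz₃) (by
    have hP3 := P.coeFn_compLp z₃
    rw [hPz₃] at hP3
    filter_upwards [e, e', Lp.coeFn_sub zw p, Lp.coeFn_sub zu p, Lp.coeFn_sub zw zu,
      Lp.coeFn_sub (zw - zu) z₃, hP3, Lp.coeFn_zero X 2 (volume : Measure ℝ)]
      with t g1 g2 g3 g4 g5 g6 g7 g8 g9
    have g1 := g1 g9
    have g2 := g2 g9
    rw [g3, Pi.sub_apply, map_sub, sub_eq_zero] at g1
    rw [g4, Pi.sub_apply, sub_eq_zero] at g2
    rw [g6, Pi.sub_apply, g5, Pi.sub_apply, map_sub, map_sub, ← g7, g8, Pi.zero_apply, g1, g2]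
    simp [hPdef])
  obtain ⟨G', v', hext, hv'⟩ := exists_isCausalExtension_of_density (T := T)
    (f := fun t => f t - φ t) hm hσp hy₂0 hyx₃ (by
      filter_upwards [hd, hw.eq_smul, hu.eq_smul, Lp.coeFn_sub (w - u) x₃, Lp.coeFn_sub w u]
        with t g1 g2 g3 g4 g5 g6 g7
      have := g1 g7
      rw [g4, Pi.sub_apply, g5, Pi.sub_apply, g2 g6 g7, g3 g6 g7, sub_eq_zero] at this
      rw [← this, smul_sub])
  refine ⟨G', v', hext, ?_⟩
  calc ‖v'‖ ≤ Real.exp (σ * T) * ‖y₂‖ := hv'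
    _ ≤ Real.exp (σ * T) * (K * ‖y‖) := by gcongr
    _ ≤ _ := by gcongr

/-- On the zero space the hypotheses do not relate $\alpha_\sigma$ to $M_\sigma$, so the error
estimate is settled separately there. -/
theorem hZeroNorm_of_subsingleton [Subsingleton X] {r : ℝ} (f : ℝ → X) :
    hZeroNorm r T f = 0 := by
  refine le_antisymm ?_ bot_le
  have h : IsCausalExtension r T f (0 : LTwo X) 0 :=
    ⟨by rw [besselPotential_eq_iff]; exact Eventually.of_forall fun _ => Subsingleton.elim _ _,
      Eventually.of_forall fun _ _ => Subsingleton.elim _ _,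
      Eventually.of_forall fun _ _ _ => Subsingleton.elim _ _⟩
  simpa using hZeroNorm_le_of_isCausalExtension h

/-- The quotient norm is an infimum over extensions, possibly empty; `0 < C` excludes the product
$0\cdot\infty$ and permits division. -/
theorem hZeroNorm_le_mul {V W : Type*} [NormedAddCommGroup V] [NormedSpace ℂ V]
    [CompleteSpace V] [NormedAddCommGroup W] [NormedSpace ℂ W] [CompleteSpace W] {r r' C : ℝ}
    (hC : 0 < C) {f : ℝ → V} {f' : ℝ → W}
    (h : ∀ G v : LTwo W, IsCausalExtension r' T f' G v →
      hZeroNorm r T f ≤ ENNReal.ofReal (C * ‖v‖)) :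
    hZeroNorm r T f ≤ ENNReal.ofReal C * hZeroNorm r' T f' := by
  have hC0 : ENNReal.ofReal C ≠ 0 := by simpa using hC
  rw [← ENNReal.div_le_iff' hC0 ENNReal.ofReal_ne_top]
  refine le_iInf fun G => le_iInf fun v => le_iInf fun hGv => ?_
  rw [ENNReal.div_le_iff' hC0 ENNReal.ofReal_ne_top, ← ofReal_norm, ← ENNReal.ofReal_mul hC.le]
  exact h G v hGv

end GalerkinSolution

end

end OperationalCalculus

/-! ### The choice of the constants and the final estimates. -/

theorem lemma4p1 (m T : ℝ) (hm : 0 ≤ m) (hT : 0 < T) :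
    ∃ c : ℝ, 0 < c ∧
      ∀ (X : Type*) [NormedAddCommGroup X] [InnerProductSpace ℂ X] [CompleteSpace X]
        (A : ℂ → X →L[ℂ] X →L⋆[ℂ] ℂ) (M α : ℝ → ℝ),
        DifferentiableOn ℂ A {s : ℂ | 0 < s.re} →
        (∀ σ : ℝ, 0 < σ → ∀ s : ℂ, σ ≤ s.re → ‖A s‖ ≤ M σ * ‖s‖ ^ 2) →
        (∀ σ : ℝ, 0 < σ → 0 < α σ) →
        (∀ σ : ℝ, 0 < σ → ∀ s : ℂ, σ ≤ s.re → ∀ x : X,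
          α σ * ‖s⁻¹ • x‖ ^ 2 ≤ (A s x x).re) →
        ∀ (Xh : Submodule ℂ X) [FiniteDimensional ℂ Xh] (g : ℝ → X →L⋆[ℂ] ℂ),
          OperationalCalculus.MemHZero (m + 2) T g →
          ∃ φh : ℝ → X,
            (OperationalCalculus.MemHZero m T φh ∧
              OperationalCalculus.IsGalerkinSolution T A Xh g φh) ∧
            (∀ ψ : ℝ → X, OperationalCalculus.MemHZero m T ψ →
              OperationalCalculus.IsGalerkinSolution T A Xh g ψ →
              ∀ᵐ t : ℝ, 0 < t → t < T → ψ t = φh t) ∧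
            OperationalCalculus.hZeroNorm m T φh
              ≤ ENNReal.ofReal (c / α (1 / T)) * OperationalCalculus.hZeroNorm (m + 2) T g ∧
            ∀ φ : ℝ → X, OperationalCalculus.MemHZero m T φ →
              OperationalCalculus.IsSolution T A g φ →
              OperationalCalculus.hZeroNorm m T (fun t => φh t - φ t)
                ≤ ENNReal.ofReal (c * M (1 / T) / α (1 / T)) *
                  OperationalCalculus.hZeroNorm (m + 4) T (fun t => Xh.starProjection (φ t) - φ t) := by
  have hpi : 1 ≤ 2 * Real.pi := by linarith [Real.pi_gt_three]
  set σ : ℝ := 1 / T with hσdef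
  have hσ : 0 < σ := by positivity
  have hσT : σ * T = 1 := by rw [hσdef]; field_simp
  -- The factors come from the weight, $e^{\sigma T}=e$, from the comparison of $(1+s)^r$ with the
  -- Bessel weight, and from absorbing the summand $1$ of the error symbol by
  -- $\alpha_\sigma\le\sigma^4M_\sigma$.
  set c : ℝ := Real.exp 1 * (2 * Real.pi) ^ (m + 4) * (1 + σ ^ 4) with hc
  have hc0 : 0 < c := by positivity
  refine ⟨c, hc0, ?_⟩
  intro X _ _ _ A M α hA hM hα hcoer Xh _ g hg
  -- Both the line $\operatorname{Re}s=\sigma$ and the line $\operatorname{Re}s=1$ defining the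
  -- kernel must lie inside the half-plane of the symbols.
  obtain ⟨σ₀, hσ₀, hσ₀σ, hσ₀1⟩ : ∃ σ₀ : ℝ, 0 < σ₀ ∧ σ₀ < σ ∧ σ₀ < 1 := by
    obtain ⟨x, hx, hx'⟩ := exists_between (lt_min hσ one_pos)
    exact ⟨x, hx, lt_min_iff.1 hx'⟩
  obtain ⟨B, hsys, hB⟩ := OperationalCalculus.exists_isGalerkinSystem hA hM hα hcoer Xh hσ₀
  have hdec : OperationalCalculus.IsDecaying σ₀ fun s => (s ^ 4)⁻¹ • A s :=
    OperationalCalculus.isDecaying_of_quadratic_growth hσ₀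
      (hA.mono fun s hs => hσ₀.trans hs) fun s hs => hM σ₀ hσ₀ s hs.le
  have hασ : 0 < α σ := hα σ hσ
  have hB' : ∀ s : ℂ, s.re = σ → ‖B s‖ ≤ (α σ)⁻¹ * ‖s‖ ^ 2 := fun s hs => by
    rw [inv_mul_eq_div]; exact hB σ hσ s hs.ge
  have hex : ∀ G v, OperationalCalculus.IsCausalExtension (m + 2) T g G v → _ := fun G v h =>
    OperationalCalculus.exists_isGalerkinSolution hsys hσ₀ hσ₀σ hσ₀1 hdec (inv_nonneg.2 hασ.le)
      hB' hm h
  obtain ⟨G₀, v₀, hGv₀⟩ := id hg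
  obtain ⟨φh, Gh, vh, hext, hgal, -⟩ := hex G₀ v₀ hGv₀
  have huniq : ∀ ψ : ℝ → X, OperationalCalculus.MemHZero m T ψ →
      OperationalCalculus.IsGalerkinSolution T A Xh g ψ →
      ∀ᵐ t : ℝ, 0 < t → t < T → ψ t = φh t := fun ψ hψ hψ' =>
    OperationalCalculus.IsGalerkinSolution.ae_eq hsys hσ₀ hσ₀σ hσ₀1 hdec hg hψ hext.memHZero
      hψ' hgal
  refine ⟨φh, ⟨hext.memHZero, hgal⟩, huniq, ?_, fun φ hφ hsol => ?_⟩
  · refine OperationalCalculus.hZeroNorm_le_mul (by positivity) fun G v hGv => ?_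
    obtain ⟨f, Gf, vf, hf, hf', hn⟩ := hex G v hGv
    -- Each extension of `g` yields its own solution with its own bound; by uniqueness all are `φh`
    -- on $(0,T)$, so the infimum over extensions may be taken.
    rw [← OperationalCalculus.hZeroNorm_congr (huniq f hf.memHZero hf')]
    refine (OperationalCalculus.hZeroNorm_le_of_isCausalExtension hf).trans ?_
    rw [← ofReal_norm]
    apply ENNReal.ofReal_le_ofReal
    rw [hσT] at hn
    have h1 : (2 * Real.pi) ^ (m + 2) ≤ (2 * Real.pi) ^ (m + 4) * (1 + σ ^ 4) :=
      (Real.rpow_le_rpow_of_exponent_le hpi (by linarith)).trans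
        (le_mul_of_one_le_right (by positivity) (by linarith [pow_pos hσ 4]))
    calc ‖vf‖ ≤ Real.exp 1 * ((α σ)⁻¹ * ((2 * Real.pi) ^ (m + 2) * ‖v‖)) := hn
      _ ≤ Real.exp 1 * ((α σ)⁻¹ * (((2 * Real.pi) ^ (m + 4) * (1 + σ ^ 4)) * ‖v‖)) := by gcongr
      _ = c / α σ * ‖v‖ := by rw [hc]; ring
  · rcases subsingleton_or_nontrivial X with hX | hX
    · rw [OperationalCalculus.hZeroNorm_of_subsingleton]
      exact bot_le
    obtain ⟨x, hx⟩ := exists_ne (0 : X)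
    have hx0 : 0 < ‖x‖ := norm_pos_iff.2 hx
    -- Coercivity and boundedness are compared at the real point $s=\sigma$ on a nonzero vector.
    have hαM : α σ ≤ σ ^ 4 * M σ := by
      have h1 := hcoer σ hσ (σ : ℂ) (by simp) x
      have h2 : (A σ x x).re ≤ M σ * σ ^ 2 * ‖x‖ * ‖x‖ := by
        have h3 := hM σ hσ (σ : ℂ) (by simp)
        rw [Complex.norm_real, Real.norm_of_nonneg hσ.le] at h3
        refine (Complex.re_le_norm _).trans (((A σ x).le_opNorm x).trans ?_)
        gcongr
        exact (A σ).le_of_opNorm_le h3 x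
      rw [norm_smul, norm_inv, Complex.norm_real, Real.norm_of_nonneg hσ.le] at h1
      have h4 : α σ * (σ⁻¹ * ‖x‖) ^ 2 ≤ σ ^ 4 * M σ * (σ⁻¹ * ‖x‖) ^ 2 := by
        refine (h1.trans h2).trans (le_of_eq ?_)
        field_simp
      exact le_of_mul_le_mul_right h4 (by positivity)
    have hMσ : 0 < M σ := by
      have : 0 < σ ^ 4 * M σ := hασ.trans_le hαM
      exact (pos_iff_pos_of_mul_pos this).1 (by positivity)
    have hK : ∀ s : ℂ, s.re = σ → 1 + ‖B s ∘L OperationalCalculus.rieszSymbol A s‖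
        ≤ (1 + σ ^ 4) * M σ / α σ * ‖1 + s‖ ^ 4 := by
      intro s hs
      have hs0 : 0 ≤ s.re := by rw [hs]; exact hσ.le
      have h1 : 1 ≤ ‖1 + s‖ := by
        have := Complex.re_le_norm (1 + s)
        simp only [Complex.add_re, Complex.one_re] at this
        linarith
      have h2 := OperationalCalculus.norm_le_norm_one_add hs0
      have h3 : ‖B s ∘L OperationalCalculus.rieszSymbol A s‖
          ≤ ((α σ)⁻¹ * ‖1 + s‖ ^ 2) * (M σ * ‖1 + s‖ ^ 2) := by
        refine (ContinuousLinearMap.opNorm_comp_le _ _).trans ?_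
        gcongr
        · exact (hB' s hs).trans (by gcongr)
        · refine (OperationalCalculus.norm_antidualEquiv_comp_le (A s)).trans ?_
          exact (hM σ hσ s hs.ge).trans (by gcongr)
      have h4 : 1 ≤ σ ^ 4 * M σ / α σ * ‖1 + s‖ ^ 4 := by
        have e1 : 1 ≤ σ ^ 4 * M σ / α σ := (one_le_div hασ).2 hαM
        exact one_le_mul_of_one_le_of_one_le e1 (one_le_pow₀ h1)
      calc 1 + ‖B s ∘L OperationalCalculus.rieszSymbol A s‖
          ≤ σ ^ 4 * M σ / α σ * ‖1 + s‖ ^ 4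
            + ((α σ)⁻¹ * ‖1 + s‖ ^ 2) * (M σ * ‖1 + s‖ ^ 2) := add_le_add h4 h3
        _ = _ := by ring
    refine OperationalCalculus.hZeroNorm_le_mul (by positivity) fun G v hGv => ?_
    obtain ⟨G', v', he, hn⟩ := OperationalCalculus.IsGalerkinSolution.exists_error_extension hsys
      hσ₀ hσ₀σ hσ₀1 hdec hK hm hg hext.memHZero hφ hgal hsol hGv
    refine (OperationalCalculus.hZeroNorm_le_of_isCausalExtension he).trans ?_
    rw [← ofReal_norm]
    apply ENNReal.ofReal_le_ofReal
    rw [hσT] at hn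
    refine hn.trans (le_of_eq ?_)
    rw [hc]
    ring
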